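/- **Setting.** Let $\mathbb G=(V,E)$ be a finite, connected, undirected physical graph: $V\subset\mathbb R^n$ is a finite set of nodes, each edge $e=\langle u,v\rangle\in E$ is the closed line segment in $\mathbb R^n$ joining two distinct nodes $u,v$, distinct edges meet at most in common end-points, and each edge has a length $w_e>0$ (not necessarily its Euclidean length). Regard $\mathbb G$ as the set of all nodes together with all points of the edges, with the topology and Borel $\sigma$-algebra induced from $\mathbb R^n$. A path in $\mathbb G$ is a finite concatenation of subsegments of edges; the subsegment of $e=\langle u,v\rangle$ between $(1-s)u+sv$ and $(1-t)u+tv$ has length $|t-s|w_e$, and the length of a path is the sum of the lengths of its pieces. Let $z_0\in V$ be a root node such that, for every $x\in\mathbb G$ (not only for nodes), the shortest path $[z_0,x]$ from $z_0$ to $x$ is unique. For $x\in\mathbb G$ and $e\in E$ put $$\Lambda(x)=\{y\in\mathbb G: x\in[z_0,y]\},\qquad \gamma_e=\{y\in\mathbb G: e\subseteq[z_0,y]\}.$$ Let $\lambda$ be the length measure on $\mathbb G$, i.e. the Borel measure that is the sum over $e=\langle u,v\rangle\in E$ of $w_e$ times the image of Lebesgue measure on $[0,1]$ under $t\mapsto(1-t)u+tv$,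 and let $\hat w(x)=1+\lambda(\Lambda(x))$. For $1\le q\le\infty$, a continuous $f:\mathbb G\to\mathbb R$ belongs to $W^{1,q}(\mathbb G,\lambda)$ if there is $h\in L^q(\mathbb G,\lambda)$ with $f(x)-f(z_0)=\int_{[z_0,x]}h\,d\lambda$ for all $x\in\mathbb G$; then $f':=h$ is the graph derivative of $f$. Let $\|h\|_{L^q_{\hat w}}=\big(\int_{\mathbb G}\hat w|h|^q\,d\lambda\big)^{1/q}$ for $q<\infty$, let $\|h\|_{L^\infty_{\hat w}}$ be the $\hat w\lambda$-essential supremum of $|h|$, and let $$\mathcal B(q,\hat w)=\{f\in W^{1,q}(\mathbb G,\lambda): f(z_0)=0,\ \|f'\|_{L^q_{\hat w}}\le1\}.$$ For finite nonnegative Borel measures $\mu,\nu$ on $\mathbb G$ and $1\le p<\infty$ with conjugate exponent $p'\in(1,\infty]$, $\frac1p+\frac1{p'}=1$ ($p'=\infty$ if $p=1$), the regularized Sobolev IPM is $$\hat{\mathcal S}_p(\mu,\nu)=\sup_{f\in\mathcal B(p',\hat w)}\Big|\int_{\mathbb G}f\,d\mu-\int_{\mathbb G}f\,d\nu\Big|\in[0,\infty].$$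 **Theorem (discrete case).** Let $1\le p<\infty$ and let $\mu,\nu$ be finite nonnegative Borel measures on $\mathbb G$ (in particular, probability measures) supported on $V$, i.e. $\mu(\mathbb G\setminus V)=\nu(\mathbb G\setminus V)=0$. Then $$\hat{\mathcal S}_p(\mu,\nu)=\Big(\sum_{e\in E}\beta_e\,|\mu(\gamma_e)-\nu(\gamma_e)|^p\Big)^{1/p},$$ where $$\beta_e=\begin{cases}\log\!\Big(1+\dfrac{w_e}{1+\lambda(\gamma_e)}\Big)&\text{if }p=2,\\[2mm]\dfrac{(1+\lambda(\gamma_e)+w_e)^{2-p}-(1+\lambda(\gamma_e))^{2-p}}{2-p}&\text{otherwise.}\end{cases}$$ In particular, the supremum is finite. -/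

import Mathlib

open MeasureTheory Set
open scoped ENNReal

/-- A finite connected physical graph in `ℝⁿ`: the nodes are points of `ℝⁿ`, the edge joining two
adjacent nodes is the straight line segment between them, two distinct edges meet at most in a
common end-point, and every edge carries a positive length (which need not be its Euclidean
length). -/
structure PhysicalGraph (n : ℕ) where
  /-- the nodes -/
  V : Finset (EuclideanSpace ℝ (Fin n))
  /-- which nodes are joined by an edge -/
  graph : SimpleGraph V
  connected : graph.Connected
  /-- the edge lengths -/
  w : graph.edgeSet → ℝ
  w_pos : ∀ e, 0 < w e
  embedded : ∀ u v u' v' : V, graph.Adj u v → graph.Adj u' v' → s(u, v) ≠ s(u', v') →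
    segment ℝ u.1 v.1 ∩ segment ℝ u'.1 v'.1 ⊆ {u.1, v.1} ∩ {u'.1, v'.1}

namespace PhysicalGraph

variable {n : ℕ} (G : PhysicalGraph n)

/-- The edges of the graph. -/
abbrev Edge : Type := G.graph.edgeSet

noncomputable instance : Fintype G.Edge := Fintype.ofFinite _

/-- The closed line segment in `ℝⁿ` spanned by an unordered pair of nodes. -/
def pairSegment : Sym2 G.V → Set (EuclideanSpace ℝ (Fin n)) :=
  Sym2.lift ⟨fun u v => segment ℝ u.1 v.1, fun u v => segment_symm ℝ u.1 v.1⟩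

/-- The continuous graph as a subset of `ℝⁿ`: all nodes together with all points of the edges. -/
def carrier : Set (EuclideanSpace ℝ (Fin n)) :=
  (G.V : Set (EuclideanSpace ℝ (Fin n))) ∪ ⋃ e : G.Edge, G.pairSegment e.1

/-- The points of the continuous graph, with the topology induced by the Euclidean distance and
the corresponding Borel `σ`-algebra. -/
abbrev Point : Type := G.carrier

/-- A node, as a point of the continuous graph. -/
def node (v : G.V) : G.Point := ⟨v.1, Or.inl v.2⟩

/-- An edge (with its end-points), as a set of points of the continuous graph. -/
def edgePoints (e : G.Edge) : Set G.Point := {x | x.1 ∈ G.pairSegment e.1}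

/-- `G.IsPath x y S ℓ`: there is a path in the continuous graph from `x` to `y` with trace `S` and
length `ℓ`. A path is a finite concatenation of subsegments of edges; the subsegment of the edge
`⟨u, v⟩` between `(1 - s) u + s v` and `(1 - t) u + t v` has length `|t - s| w_e`. -/
inductive IsPath : G.Point → G.Point → Set G.Point → ℝ → Prop
  | refl (x : G.Point) : IsPath x x {x} 0
  | step {x y z : G.Point} {S : Set G.Point} {ℓ : ℝ} (u v : G.V) (h : G.graph.Adj u v) (s t : ℝ)
      (hs : s ∈ Icc (0 : ℝ) 1) (ht : t ∈ Icc (0 : ℝ) 1)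
      (hy : y.1 = AffineMap.lineMap u.1 v.1 s) (hz : z.1 = AffineMap.lineMap u.1 v.1 t)
      (hxy : IsPath x y S ℓ) :
      IsPath x z (S ∪ {q | q.1 ∈ segment ℝ y.1 z.1}) (ℓ + |t - s| * G.w ⟨s(u, v), h⟩)

/-- `S` is (the trace of) a shortest path from `x` to `y`. -/
def IsShortestPath (x y : G.Point) (S : Set G.Point) : Prop :=
  ∃ ℓ, G.IsPath x y S ℓ ∧ ∀ S' ℓ', G.IsPath x y S' ℓ' → ℓ ≤ ℓ'

/-- `z₀` is a unique-path root node: for every point `x` of the continuous graph, the shortest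
path between `z₀` and `x` is unique. -/
def IsUniquePathRoot (z₀ : G.V) : Prop :=
  ∀ x : G.Point, ∃! S, G.IsShortestPath (G.node z₀) x S

/-- The shortest path `[x, y]`, as a set. (If the shortest path is unique, this is its trace.) -/
def shortestPath (x y : G.Point) : Set G.Point := {q | ∃ S, G.IsShortestPath x y S ∧ q ∈ S}

/-- `Λ(x) = {y : x ∈ [z₀, y]}`. -/
def Lam (z₀ : G.V) (x : G.Point) : Set G.Point := {y | x ∈ G.shortestPath (G.node z₀) y}

/-- `γ_e = {y : e ⊆ [z₀, y]}`. -/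
def gam (z₀ : G.V) (e : G.Edge) : Set G.Point :=
  {y | G.edgePoints e ⊆ G.shortestPath (G.node z₀) y}

/-- Normalized length measure (of total mass one) on the segment spanned by an unordered pair of
nodes `u, v`, as a measure on `ℝⁿ`: the image of Lebesgue measure on `[0, 1]` under
`t ↦ (1 - t) u + t v`. -/
noncomputable def pairMeasure : Sym2 G.V → Measure (EuclideanSpace ℝ (Fin n)) :=
  Sym2.lift ⟨fun u v => (volume.restrict (Icc (0 : ℝ) 1)).map (AffineMap.lineMap u.1 v.1), by
    intro u v
    have hc : ∀ a b : EuclideanSpace ℝ (Fin n),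
        Measurable (fun t : ℝ => AffineMap.lineMap a b t) := fun a b =>
      AffineMap.lineMap_continuous.measurable
    have hm : MeasurePreserving (fun t : ℝ => 1 - t) volume volume :=
      Measure.measurePreserving_sub_left volume (1 : ℝ)
    have hr := hm.restrict_preimage (s := Icc (0 : ℝ) 1) measurableSet_Icc
    have hp : (fun t : ℝ => 1 - t) ⁻¹' Icc (0 : ℝ) 1 = Icc 0 1 := by
      ext t; simp only [mem_preimage, mem_Icc]; constructor <;> rintro ⟨h1, h2⟩ <;>
        constructor <;> linarith
    rw [hp] at hr
    have h2 : (AffineMap.lineMap u.1 v.1 : ℝ → EuclideanSpace ℝ (Fin n)) =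
        (AffineMap.lineMap v.1 u.1 : ℝ → EuclideanSpace ℝ (Fin n)) ∘ fun t : ℝ => 1 - t := by
      funext t
      simp [AffineMap.lineMap_apply_one_sub]
    show Measure.map (AffineMap.lineMap u.1 v.1 : ℝ → EuclideanSpace ℝ (Fin n)) _ =
      Measure.map (AffineMap.lineMap v.1 u.1 : ℝ → EuclideanSpace ℝ (Fin n)) _
    rw [h2, ← Measure.map_map (hc _ _) hm.measurable, hr.map_eq]⟩

/-- The length measure on the continuous graph: the Borel measure which on every edge `e` is the
length measure of that edge, of total mass `w_e`. -/
noncomputable def lengthMeasure : Measure G.Point :=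
  (∑ e : G.Edge, ENNReal.ofReal (G.w e) • G.pairMeasure e.1).comap Subtype.val

/-- The weight function `ŵ(x) = 1 + lam(Λ(x))`. -/
noncomputable def weight (z₀ : G.V) (lam : Measure G.Point) (x : G.Point) : ℝ≥0∞ :=
  1 + lam (G.Lam z₀ x)

/-- The weighted norm of `L^q_ŵ(G, lam)`, i.e. the `L^q`-norm for the measure `ŵ lam`: it is
`(∫ ŵ |h|^q ∂lam)^(1/q)` if `q < ∞`, and the `ŵ lam`-essential supremum of `|h|` if `q = ∞`. -/
noncomputable def weightedNorm (z₀ : G.V) (lam : Measure G.Point) (q : ℝ≥0∞) (h : G.Point → ℝ) :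
    ℝ≥0∞ :=
  eLpNorm h q (lam.withDensity (G.weight z₀ lam))

/-- `f` belongs to the Sobolev space `W^{1,q}(G, lam)`, with graph derivative `h`. -/
structure HasGraphDeriv (z₀ : G.V) (lam : Measure G.Point) (q : ℝ≥0∞) (f h : G.Point → ℝ) :
    Prop where
  continuous : Continuous f
  memLp : MemLp h q lam
  ftc : ∀ x, f x - f (G.node z₀) = ∫ y in G.shortestPath (G.node z₀) x, h y ∂lam

/-- The unit ball `B(q, ŵ)`: the functions `f` of `W^{1,q}(G, lam)` with `f(z₀) = 0` whose graph
derivative has weighted norm at most one. -/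
def regBall (z₀ : G.V) (lam : Measure G.Point) (q : ℝ≥0∞) : Set (G.Point → ℝ) :=
  {f | f (G.node z₀) = 0 ∧ ∃ h, G.HasGraphDeriv z₀ lam q f h ∧ G.weightedNorm z₀ lam q h ≤ 1}

/-- The regularized Sobolev IPM of order `p`, as a supremum in `[0, ∞]`. The ball is taken for the
conjugate exponent `p'` (`1/p + 1/p' = 1`), so that `p' = ∞` for `p = 1`. -/
noncomputable def regSobolevIPM (z₀ : G.V) (lam : Measure G.Point) (p : ℝ≥0∞)
    (μ ν : Measure G.Point) : ℝ≥0∞ :=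
  ⨆ f ∈ G.regBall z₀ lam p.conjExponent, ENNReal.ofReal |∫ x, f x ∂μ - ∫ x, f x ∂ν|

/-- The edge weight `β_e`. -/
noncomputable def edgeWeight (z₀ : G.V) (p : ℝ) (e : G.Edge) : ℝ :=
  if p = 2 then Real.log (1 + G.w e / (1 + G.lengthMeasure.real (G.gam z₀ e)))
  else ((1 + G.lengthMeasure.real (G.gam z₀ e) + G.w e) ^ (2 - p)
    - (1 + G.lengthMeasure.real (G.gam z₀ e)) ^ (2 - p)) / (2 - p)

end PhysicalGraph

/-!
Uniqueness of the shortest paths to *all* points of the graph determines how these paths run.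
Along an edge `⟨u, v⟩` of length `w` the distance from the root is `min (d u + t w) (d v + (1 - t)
w)`, so if `|d u - d v| < w`, some interior point is equally far through both ends and has two
shortest paths (`IsUniquePathRoot.depth_adj`). Hence every edge can be oriented from a tail `u` to
a head `v` with `d v = d u + w`, and every node other than the root is the head of an edge
(`IsUniquePathRoot.exists_parent`), through which its shortest path arrives. By induction the
shortest path to a node is, up to finitely many points, the union of the edges `e` with that node
in `γ_e` (`IsUniquePathRoot.node_mem_gam_iff`), and what lies behind an interior point of `e` is
the rest of `e` together with `γ_e` (`IsUniquePathRoot.Lam_edgePt`).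

The rest is duality. For a function `f` with graph derivative `h` and measures `μ, ν` carried by
the nodes, summation by parts gives `∫ f dμ - ∫ f dν = ∑ e, (μ γ_e - ν γ_e) ∫_e h dλ`
(`IsUniquePathRoot.integral_sub_integral`). This is the integral of `h g` for the measure `ŵ λ`,
where `g = (μ γ_e - ν γ_e) / ŵ` on `e`. By Hölder's inequality and its extremal function
(`ofReal_abs_integral_mul_le`, `exists_integral_mul_eq`) the supremum over the unit ball of
`L^{p'}(ŵ λ)` is the norm of `g` in `L^p(ŵ λ)`. The extremal `h` is bounded, so that it is the
graph derivative of a continuous function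
(`IsUniquePathRoot.continuous_setIntegral_shortestPath`). Finally the `p`-th power of the norm of
`g` is `∑ e, |μ γ_e - ν γ_e| ^ p ∫_e ŵ ^ (1 - p) dλ`. On `e` the weight is affine,
running from `1 + λ γ_e + w_e` at the tail to `1 + λ γ_e` at the head
(`IsUniquePathRoot.weight_edgePt`), so the integral over `e` is `β_e` (`edgeWeight_eq_integral`).
-/

/-! ### Duality of Lebesgue norms -/

section Duality

variable {X : Type*} [MeasurableSpace X] {ρ : Measure X} [IsFiniteMeasure ρ] {p C : ℝ} {g : X → ℝ}

theorem memLp_of_abs_le (hg : Measurable g) (hC : ∀ x, |g x| ≤ C) (q : ℝ≥0∞) : MemLp g q ρ :=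
  MemLp.of_bound hg.aestronglyMeasurable C (ae_of_all _ hC)

/-- Hölder's inequality, for the exponents `p` and its conjugate. -/
theorem ofReal_abs_integral_mul_le (hp : 1 ≤ p) (hg : Measurable g) (hC : ∀ x, |g x| ≤ C)
    {h : X → ℝ} (hh : AEStronglyMeasurable h ρ)
    (hnorm : eLpNorm h (ENNReal.ofReal p).conjExponent ρ ≤ 1) :
    ENNReal.ofReal |∫ x, h x * g x ∂ρ| ≤ ENNReal.ofReal ((∫ x, |g x| ^ p ∂ρ) ^ (1 / p)) := by
  have hp0 : 0 < p := by linarith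
  have hp1 : 1 ≤ ENNReal.ofReal p := ENNReal.one_le_ofReal.2 hp
  have : ENNReal.HolderTriple (ENNReal.ofReal p).conjExponent (ENNReal.ofReal p) 1 :=
    (ENNReal.HolderConjugate.conjExponent hp1).symm
  calc ENNReal.ofReal |∫ x, h x * g x ∂ρ|
      ≤ ∫⁻ x, ‖h x * g x‖ₑ ∂ρ := by
        rw [← Real.norm_eq_abs, ofReal_norm]
        exact enorm_integral_le_lintegral_enorm _
    _ = eLpNorm (h • g) 1 ρ := by rw [eLpNorm_one_eq_lintegral_enorm]; rfl
    _ ≤ eLpNorm h (ENNReal.ofReal p).conjExponent ρ * eLpNorm g (ENNReal.ofReal p) ρ :=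
        eLpNorm_smul_le_mul_eLpNorm hg.aestronglyMeasurable hh
    _ ≤ eLpNorm g (ENNReal.ofReal p) ρ := mul_le_of_le_one_left' hnorm
    _ = ENNReal.ofReal ((∫ x, |g x| ^ p ∂ρ) ^ (1 / p)) := by
        rw [(memLp_of_abs_le hg hC _).eLpNorm_eq_integral_rpow_norm
          (zero_lt_one.trans_le hp1).ne' ENNReal.ofReal_ne_top, ENNReal.toReal_ofReal hp0.le,
          one_div]
        rfl

/-- Hölder's inequality is attained by a multiple of `sign g * |g| ^ (p - 1)`, which is bounded. -/
theorem exists_integral_mul_eq (hp : 1 ≤ p) (hg : Measurable g) (hC : ∀ x, |g x| ≤ C) :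
    ∃ h : X → ℝ, Measurable h ∧ (∃ C', ∀ x, |h x| ≤ C') ∧
      eLpNorm h (ENNReal.ofReal p).conjExponent ρ ≤ 1 ∧
      ∫ x, h x * g x ∂ρ = (∫ x, |g x| ^ p ∂ρ) ^ (1 / p) := by
  have hp0 : 0 < p := by linarith
  set A := ∫ x, |g x| ^ p ∂ρ with hA
  have hA0 : 0 ≤ A := integral_nonneg fun x => by positivity
  rcases hA0.eq_or_lt with h0 | hApos
  · refine ⟨0, measurable_zero, ⟨0, by simp⟩, by simp, ?_⟩
    simp [← h0, Real.zero_rpow (inv_ne_zero hp0.ne')]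
  -- The factor `B` normalizes `sign g * |g| ^ (p - 1)`. For `p = 1` it is `1`, and the zeros of
  -- `g`, where `|g| ^ 0 = 1`, are taken care of by `sign 0 = 0`.
  set B := A ^ (-((p - 1) / p)) with hB
  have hB0 : 0 < B := Real.rpow_pos_of_pos hApos _
  let h : X → ℝ := fun x => SignType.sign (g x) * (|g x| ^ (p - 1) * B)
  have hsign : ∀ y : ℝ, |((SignType.sign y : SignType) : ℝ)| ≤ 1 := fun y => by
    rcases lt_trichotomy y 0 with hy | rfl | hy
    · simp [sign_neg hy]
    · simp
    · simp [sign_pos hy]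
  have hle : ∀ x, |h x| ≤ |g x| ^ (p - 1) * B := fun x => by
    have : 0 ≤ |g x| ^ (p - 1) * B := by positivity
    rw [abs_mul, abs_of_nonneg this]
    exact mul_le_of_le_one_left this (hsign _)
  have hCx : ∀ x, |g x| ^ (p - 1) ≤ C ^ (p - 1) := fun x =>
    Real.rpow_le_rpow (abs_nonneg _) (hC x) (by linarith)
  have hmeas : Measurable h := by
    have : Measurable fun y : ℝ => ((SignType.sign y : SignType) : ℝ) := by
      have h1 : (fun y : ℝ => ((SignType.sign y : SignType) : ℝ)) =
          fun y => if 0 < y then 1 else if y < 0 then -1 else 0 := by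
        funext y
        rw [sign_apply]
        split_ifs <;> simp
      rw [h1]
      exact Measurable.ite measurableSet_Ioi measurable_const
        (Measurable.ite measurableSet_Iio measurable_const measurable_const)
    exact (this.comp hg).mul ((hg.abs.pow_const _).mul_const _)
  have hbd : ∀ x, |h x| ≤ C ^ (p - 1) * B := fun x =>
    (hle x).trans (mul_le_mul_of_nonneg_right (hCx x) hB0.le)
  refine ⟨h, hmeas, ⟨_, hbd⟩, ?_, ?_⟩
  · rcases hp.eq_or_lt with rfl | hp1
    · have : (ENNReal.ofReal 1).conjExponent = ∞ := by simp [ENNReal.conjExponent]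
      rw [this, eLpNorm_exponent_top]
      refine eLpNormEssSup_le_of_ae_enorm_bound (ae_of_all _ fun x => ?_)
      rw [← ofReal_norm, Real.norm_eq_abs]
      refine ENNReal.ofReal_le_one.2 ((hle x).trans ?_)
      simp [hB]
    · have hconj := Real.HolderConjugate.conjExponent hp1
      have hq0 : 0 < p.conjExponent := hconj.symm.pos
      have hq : (ENNReal.ofReal p).conjExponent = ENNReal.ofReal p.conjExponent := by
        have h1 : 1 < p.toNNReal := by simpa using hp1
        rw [ENNReal.ofReal, ← ENNReal.coe_conjExponent h1, ENNReal.ofReal]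
        refine congrArg _ (NNReal.eq ?_)
        rw [NNReal.conjExponent, NNReal.coe_div, NNReal.coe_sub h1.le, NNReal.coe_one,
          Real.coe_toNNReal _ hp0.le, Real.coe_toNNReal _ hq0.le, Real.conjExponent]
      have hmem : MemLp h (ENNReal.ofReal p.conjExponent) ρ :=
        memLp_of_abs_le hmeas hbd _
      rw [hq, hmem.eLpNorm_eq_integral_rpow_norm (by simpa using hq0) ENNReal.ofReal_ne_top,
        ENNReal.toReal_ofReal hq0.le]
      refine ENNReal.ofReal_le_one.2 (Real.rpow_le_one (integral_nonneg fun x => by positivity) ?_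
        (by positivity))
      have hpq : (p - 1) * p.conjExponent = p := hconj.sub_one_mul_conj
      have hint : Integrable (fun x => |g x| ^ p) ρ := by
        have := (memLp_of_abs_le hg hC (ρ := ρ) (ENNReal.ofReal p)).integrable_norm_rpow'
        rwa [ENNReal.toReal_ofReal hp0.le] at this
      have hBq : B ^ p.conjExponent = A⁻¹ := by
        rw [hB, ← Real.rpow_mul hA0, ← Real.rpow_neg_one]
        congr 1
        rw [neg_mul, div_mul_eq_mul_div, hpq, div_self hp0.ne']
      calc ∫ x, ‖h x‖ ^ p.conjExponent ∂ρ ≤ ∫ x, |g x| ^ p * A⁻¹ ∂ρ := by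
            refine integral_mono_of_nonneg (ae_of_all _ fun x => by positivity)
              (hint.mul_const _) (ae_of_all _ fun x => ?_)
            calc ‖h x‖ ^ p.conjExponent ≤ (|g x| ^ (p - 1) * B) ^ p.conjExponent :=
                  Real.rpow_le_rpow (norm_nonneg _) (hle x) hq0.le
              _ = |g x| ^ p * A⁻¹ := by
                  rw [Real.mul_rpow (by positivity) hB0.le, ← Real.rpow_mul (abs_nonneg _), hpq,
                    hBq]
        _ = 1 := by rw [integral_mul_const, ← hA, mul_inv_cancel₀ hApos.ne']
  · have : ∀ x, h x * g x = |g x| ^ p * B := fun x => by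
      have h1 : |g x| ^ (p - 1) * |g x| = |g x| ^ p := by
        rcases eq_or_ne (g x) 0 with h0 | h0
        · simp [h0, Real.zero_rpow hp0.ne']
        · rw [← Real.rpow_add_one (abs_ne_zero.2 h0), sub_add_cancel]
      calc h x * g x = (SignType.sign (g x) * g x) * (|g x| ^ (p - 1) * B) := by ring
        _ = |g x| ^ p * B := by rw [sign_mul_self, ← h1]; ring
    simp_rw [this]
    rw [integral_mul_const, ← hA, hB, ← Real.rpow_one_add' hA0]
    · congr 1
      field_simp
      ring
    · field_simp
      ring_nf
      positivity

end Duality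

namespace PhysicalGraph

variable {n : ℕ} {G : PhysicalGraph n} {z₀ : G.V}

/-! ### Points on edges -/

theorem node_injective : Function.Injective G.node := fun _ _ h =>
  Subtype.ext (congrArg (fun p : G.Point => p.1) h)

theorem lineMap_injective_of_adj {u v : G.V} (h : G.graph.Adj u v) :
    Function.Injective (AffineMap.lineMap u.1 v.1 : ℝ → EuclideanSpace ℝ (Fin n)) :=
  AffineMap.lineMap_injective ℝ fun h' => h.ne (Subtype.ext h')

theorem w_swap {u v : G.V} (h : G.graph.Adj u v) :
    G.w ⟨s(v, u), h.symm⟩ = G.w ⟨s(u, v), h⟩ :=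
  congrArg G.w (Subtype.ext Sym2.eq_swap)

theorem lineMap_mem_segment {t : ℝ} (ht : t ∈ Icc (0 : ℝ) 1) (a b : EuclideanSpace ℝ (Fin n)) :
    AffineMap.lineMap a b t ∈ segment ℝ a b := by
  rw [segment_eq_image_lineMap]; exact mem_image_of_mem _ ht

theorem lineMap_mem_carrier {u v : G.V} (h : G.graph.Adj u v) {t : ℝ} (ht : t ∈ Icc (0 : ℝ) 1) :
    (AffineMap.lineMap u.1 v.1 t : EuclideanSpace ℝ (Fin n)) ∈ G.carrier :=
  Or.inr (mem_iUnion.2 ⟨⟨s(u, v), h⟩, lineMap_mem_segment ht _ _⟩)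

/-- A point lying on two edges is either the same point of the same edge, or an end of both. -/
theorem lineMap_eq_cases {u v u' v' : G.V} (h : G.graph.Adj u v) (h' : G.graph.Adj u' v')
    {t t' : ℝ} (ht : t ∈ Icc (0 : ℝ) 1) (ht' : t' ∈ Icc (0 : ℝ) 1)
    (heq : (AffineMap.lineMap u.1 v.1 t : EuclideanSpace ℝ (Fin n)) =
      AffineMap.lineMap u'.1 v'.1 t') :
    (u = u' ∧ v = v' ∧ t = t') ∨ (u = v' ∧ v = u' ∧ t = 1 - t') ∨
      (s(u, v) ≠ s(u', v') ∧ (t = 0 ∨ t = 1) ∧ (t' = 0 ∨ t' = 1)) := by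
  by_cases hs : s(u, v) = s(u', v')
  · rcases Sym2.eq_iff.1 hs with ⟨rfl, rfl⟩ | ⟨rfl, rfl⟩
    · exact Or.inl ⟨rfl, rfl, lineMap_injective_of_adj h heq⟩
    · refine Or.inr (Or.inl ⟨rfl, rfl, lineMap_injective_of_adj h ?_⟩)
      rw [heq, AffineMap.lineMap_apply_one_sub]
  · have key := G.embedded u v u' v' h h' hs
      ⟨lineMap_mem_segment ht _ _, heq ▸ lineMap_mem_segment ht' _ _⟩
    refine Or.inr (Or.inr ⟨hs, ?_, ?_⟩)
    · rcases key.1 with h1 | h1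
      · exact Or.inl (lineMap_injective_of_adj h (by rw [h1, AffineMap.lineMap_apply_zero]))
      · exact Or.inr (lineMap_injective_of_adj h (by
          rw [mem_singleton_iff.1 h1, AffineMap.lineMap_apply_one]))
    · rcases key.2 with h1 | h1
      · exact Or.inl (lineMap_injective_of_adj h' (by
          rw [← heq, h1, AffineMap.lineMap_apply_zero]))
      · exact Or.inr (lineMap_injective_of_adj h' (by
          rw [← heq, mem_singleton_iff.1 h1, AffineMap.lineMap_apply_one]))

/-- The only nodes on an edge are its ends: the graph being connected, any other node would be an
end of another edge. -/
theorem node_eq_lineMap {u v a : G.V} (h : G.graph.Adj u v) {t : ℝ} (ht : t ∈ Icc (0 : ℝ) 1)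
    (ha : a.1 = AffineMap.lineMap u.1 v.1 t) : (a = u ∧ t = 0) ∨ (a = v ∧ t = 1) := by
  have : Nontrivial G.V := ⟨u, v, h.ne⟩
  obtain ⟨b, hb⟩ := G.connected.preconnected.exists_adj_of_nontrivial a
  rcases lineMap_eq_cases h hb ht (left_mem_Icc.2 zero_le_one)
    (by rw [← ha, AffineMap.lineMap_apply_zero]) with ⟨h1, -, h2⟩ | ⟨-, h1, h2⟩ | ⟨-, h1 | h1, -⟩
  · exact Or.inl ⟨h1.symm, h2⟩
  · exact Or.inr ⟨h1.symm, by simpa using h2⟩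
  · exact Or.inl ⟨Subtype.ext (by rw [ha, h1, AffineMap.lineMap_apply_zero]), h1⟩
  · exact Or.inr ⟨Subtype.ext (by rw [ha, h1, AffineMap.lineMap_apply_one]), h1⟩

theorem segment_lineMap (a b : EuclideanSpace ℝ (Fin n)) (s t : ℝ) :
    segment ℝ (AffineMap.lineMap a b s : EuclideanSpace ℝ (Fin n)) (AffineMap.lineMap a b t) =
      AffineMap.lineMap a b '' uIcc s t := by
  rw [← segment_eq_uIcc, image_segment]

/-! ### Distance from the root -/

theorem IsPath.length_nonneg {x y : G.Point} {S : Set G.Point} {ℓ : ℝ} (h : G.IsPath x y S ℓ) :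
    0 ≤ ℓ := by
  induction h with
  | refl => exact le_rfl
  | step u v h s t hs ht hy hz hxy ih =>
    exact add_nonneg ih (mul_nonneg (abs_nonneg _) (G.w_pos _).le)

variable (z₀) in
/-- The distance of a point from the root: the infimum of the lengths of all paths. -/
noncomputable def depth (x : G.Point) : ℝ := sInf {ℓ | ∃ S, G.IsPath (G.node z₀) x S ℓ}

theorem IsPath.depth_le {x : G.Point} {S : Set G.Point} {ℓ : ℝ}
    (h : G.IsPath (G.node z₀) x S ℓ) : depth z₀ x ≤ ℓ :=
  csInf_le ⟨0, fun _ ⟨_, h⟩ => h.length_nonneg⟩ ⟨S, h⟩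

theorem isShortestPath_iff {x : G.Point} {S : Set G.Point} :
    G.IsShortestPath (G.node z₀) x S ↔ G.IsPath (G.node z₀) x S (depth z₀ x) := by
  constructor
  · rintro ⟨ℓ, h, hmin⟩
    have : IsLeast {ℓ | ∃ S, G.IsPath (G.node z₀) x S ℓ} ℓ :=
      ⟨⟨S, h⟩, fun ℓ' ⟨S', h'⟩ => hmin S' ℓ' h'⟩
    rwa [depth, this.csInf_eq]
  · exact fun h => ⟨_, h, fun S' ℓ' h' => h'.depth_le⟩

theorem depth_root : depth z₀ (G.node z₀) = 0 :=
  le_antisymm (IsPath.refl _).depth_le (Real.sInf_nonneg fun _ ⟨_, h⟩ => h.length_nonneg)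

theorem depth_nonneg (x : G.Point) : 0 ≤ depth z₀ x :=
  Real.sInf_nonneg fun _ ⟨_, h⟩ => h.length_nonneg

/-- A path passes only through points that are at most as far from the root as its length. -/
theorem IsPath.depth_le_of_mem {z q : G.Point} {S : Set G.Point} {ℓ : ℝ}
    (h : G.IsPath (G.node z₀) z S ℓ) (hq : q ∈ S) : depth z₀ q ≤ ℓ := by
  induction h with
  | refl => rw [mem_singleton_iff.1 hq, depth_root]
  | @step y z S ℓ u v h s t hs ht hy hz hxy ih =>
    rcases hq with hq | hq
    · exact (ih hq).trans
        (le_add_of_nonneg_right (mul_nonneg (abs_nonneg _) (G.w_pos _).le))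
    · rw [mem_ofPred_eq, hy, hz, segment_lineMap] at hq
      obtain ⟨r, hr, hrq⟩ := hq
      have hr' : r ∈ Icc (0 : ℝ) 1 := uIcc_subset_Icc hs ht hr
      refine (IsPath.step u v h s r hs hr' hy hrq.symm hxy).depth_le.trans ?_
      have : |r - s| ≤ |t - s| := abs_sub_left_of_mem_uIcc hr
      exact add_le_add_right (mul_le_mul_of_nonneg_right this (G.w_pos _).le) _

/-- A path to an interior point of an edge arrives there through one of the ends of the edge. -/
theorem IsPath.depth_add_le {u v : G.V} (h : G.graph.Adj u v) {t : ℝ} (ht : t ∈ Icc (0 : ℝ) 1)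
    {z : G.Point} (hz : z.1 = AffineMap.lineMap u.1 v.1 t) {S : Set G.Point} {ℓ : ℝ}
    (hP : G.IsPath (G.node z₀) z S ℓ) :
    depth z₀ (G.node u) + t * G.w ⟨s(u, v), h⟩ ≤ ℓ ∨
      depth z₀ (G.node v) + (1 - t) * G.w ⟨s(u, v), h⟩ ≤ ℓ := by
  -- At an end of the edge the claim is the definition of the depth.
  have hend : ∀ {z : G.Point} {S : Set G.Point} {ℓ t : ℝ}, G.IsPath (G.node z₀) z S ℓ →
      z.1 = AffineMap.lineMap u.1 v.1 t → t = 0 ∨ t = 1 →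
      depth z₀ (G.node u) + t * G.w ⟨s(u, v), h⟩ ≤ ℓ ∨
      depth z₀ (G.node v) + (1 - t) * G.w ⟨s(u, v), h⟩ ≤ ℓ := by
    rintro z S ℓ t hP hz (rfl | rfl)
    · have : z = G.node u := Subtype.ext (by rw [hz, AffineMap.lineMap_apply_zero]; rfl)
      subst this
      exact Or.inl (by simpa using hP.depth_le)
    · have : z = G.node v := Subtype.ext (by rw [hz, AffineMap.lineMap_apply_one]; rfl)
      subst this
      exact Or.inr (by simpa using hP.depth_le)
  induction hP generalizing t with
  | refl =>
    refine hend (IsPath.refl _) hz ?_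
    rcases node_eq_lineMap h ht hz with h | h
    exacts [Or.inl h.2, Or.inr h.2]
  | @step y z S ℓ u' v' h' s' t' hs' ht' hy hz' hxy ih =>
    have hw := G.w_pos ⟨s(u, v), h⟩
    rcases lineMap_eq_cases h h' ht ht' (hz.symm.trans hz') with
      ⟨rfl, rfl, rfl⟩ | ⟨rfl, rfl, rfl⟩ | ⟨-, h0, -⟩
    · have h1 := le_abs_self (t - s')
      have h2 := neg_abs_le (t - s')
      rcases ih hs' hy with h3 | h3
      · left; nlinarith
      · right; nlinarith
    · have h1 := le_abs_self (t' - s')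
      have h2 := neg_abs_le (t' - s')
      rw [w_swap h]
      rcases ih (t := 1 - s') ⟨by linarith [hs'.2], by linarith [hs'.1]⟩
        (by rw [hy, AffineMap.lineMap_apply_one_sub]) with h3 | h3
      · left; nlinarith
      · right; nlinarith
    · exact hend (IsPath.step u' v' h' s' t' hs' ht' hy hz' hxy) hz h0

namespace IsUniquePathRoot

variable (hz₀ : G.IsUniquePathRoot z₀)
include hz₀

theorem exists_path (x : G.Point) : ∃ S, G.IsPath (G.node z₀) x S (depth z₀ x) :=
  let ⟨S, h, _⟩ := hz₀ x
  ⟨S, isShortestPath_iff.1 h⟩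

theorem shortestPath_eq {x : G.Point} {S : Set G.Point}
    (h : G.IsPath (G.node z₀) x S (depth z₀ x)) : G.shortestPath (G.node z₀) x = S := by
  ext q
  refine ⟨fun ⟨S', h', hq⟩ => ?_, fun hq => ⟨S, isShortestPath_iff.2 h, hq⟩⟩
  rwa [(hz₀ x).unique (isShortestPath_iff.2 h) h']

theorem isPath_shortestPath (x : G.Point) :
    G.IsPath (G.node z₀) x (G.shortestPath (G.node z₀) x) (depth z₀ x) := by
  obtain ⟨S, hS⟩ := hz₀.exists_path x
  rwa [hz₀.shortestPath_eq hS]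

theorem depth_le_of_mem {x y : G.Point} (h : x ∈ G.shortestPath (G.node z₀) y) :
    depth z₀ x ≤ depth z₀ y :=
  (hz₀.isPath_shortestPath y).depth_le_of_mem h

theorem shortestPath_root : G.shortestPath (G.node z₀) (G.node z₀) = {G.node z₀} :=
  hz₀.shortestPath_eq (by rw [depth_root]; exact IsPath.refl _)

theorem depth_le_step {u v : G.V} (h : G.graph.Adj u v) {s t : ℝ} (hs : s ∈ Icc (0 : ℝ) 1)
    (ht : t ∈ Icc (0 : ℝ) 1) {y z : G.Point} (hy : y.1 = AffineMap.lineMap u.1 v.1 s)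
    (hz : z.1 = AffineMap.lineMap u.1 v.1 t) :
    depth z₀ z ≤ depth z₀ y + |t - s| * G.w ⟨s(u, v), h⟩ :=
  (IsPath.step u v h s t hs ht hy hz (hz₀.isPath_shortestPath y)).depth_le

theorem shortestPath_step {u v : G.V} (h : G.graph.Adj u v) {s t : ℝ} (hs : s ∈ Icc (0 : ℝ) 1)
    (ht : t ∈ Icc (0 : ℝ) 1) {y z : G.Point} (hy : y.1 = AffineMap.lineMap u.1 v.1 s)
    (hz : z.1 = AffineMap.lineMap u.1 v.1 t)
    (hd : depth z₀ z = depth z₀ y + |t - s| * G.w ⟨s(u, v), h⟩) :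
    G.shortestPath (G.node z₀) z =
      G.shortestPath (G.node z₀) y ∪ {q | q.1 ∈ segment ℝ y.1 z.1} :=
  hz₀.shortestPath_eq
    (by rw [hd]; exact IsPath.step u v h s t hs ht hy hz (hz₀.isPath_shortestPath y))

/-- Otherwise an interior point of the edge would have two shortest paths, one through each end. -/
theorem depth_adj {u v : G.V} (h : G.graph.Adj u v) :
    depth z₀ (G.node v) = depth z₀ (G.node u) + G.w ⟨s(u, v), h⟩ ∨
      depth z₀ (G.node u) = depth z₀ (G.node v) + G.w ⟨s(u, v), h⟩ := by
  have h01 : (0 : ℝ) ∈ Icc (0 : ℝ) 1 := left_mem_Icc.2 zero_le_one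
  have h11 : (1 : ℝ) ∈ Icc (0 : ℝ) 1 := right_mem_Icc.2 zero_le_one
  have hu : (G.node u).1 = AffineMap.lineMap u.1 v.1 (0 : ℝ) := by
    rw [AffineMap.lineMap_apply_zero]; rfl
  have hv : (G.node v).1 = AffineMap.lineMap u.1 v.1 (1 : ℝ) := by
    rw [AffineMap.lineMap_apply_one]; rfl
  have h1 := hz₀.depth_le_step h h01 h11 hu hv
  have h2 := hz₀.depth_le_step h h11 h01 hv hu
  have hw := G.w_pos ⟨s(u, v), h⟩
  rw [sub_zero, abs_one, one_mul] at h1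
  rw [zero_sub, abs_neg, abs_one, one_mul] at h2
  by_contra! hne
  have h1' := lt_of_le_of_ne h1 hne.1
  have h2' := lt_of_le_of_ne h2 hne.2
  set a := depth z₀ (G.node u)
  set b := depth z₀ (G.node v)
  set w := G.w ⟨s(u, v), h⟩
  -- `t` is the position of the point which is equally far from the root through both ends.
  obtain ⟨t, ht⟩ : ∃ t : ℝ, a + t * w = b + (1 - t) * w :=
    ⟨(b - a + w) / (2 * w), by field_simp; ring⟩
  have ht0 : 0 < t := by
    by_contra! hc
    nlinarith
  have ht1 : t < 1 := by
    by_contra! hc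
    nlinarith
  have htI : t ∈ Icc (0 : ℝ) 1 := ⟨ht0.le, ht1.le⟩
  have hdep : ∀ (r : ℝ) (hr : r ∈ Icc (0 : ℝ) 1),
      min (a + r * w) (b + (1 - r) * w) ≤ depth z₀ (⟨_, lineMap_mem_carrier h hr⟩ : G.Point) :=
    fun r hr => min_le_iff.2 ((hz₀.isPath_shortestPath _).depth_add_le h hr rfl)
  let z : G.Point := ⟨_, lineMap_mem_carrier h htI⟩
  have hzu : depth z₀ z = a + |t - 0| * w := by
    refine le_antisymm (hz₀.depth_le_step h h01 htI hu rfl) ?_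
    rw [sub_zero, abs_of_pos ht0]
    have := hdep t htI
    rwa [← ht, min_self] at this
  have hzv : depth z₀ z = b + |t - 1| * w := by
    rw [hzu, sub_zero, abs_of_pos ht0, abs_of_neg (by linarith), neg_sub]; exact ht
  have e1 := hz₀.shortestPath_step h h01 htI hu rfl hzu
  have e2 := hz₀.shortestPath_step h h11 htI hv rfl hzv
  -- A point slightly beyond `t` lies on the path through `v` but not on the one through `u`.
  obtain ⟨r, hrt, hr1, hr2⟩ : ∃ r, t < r ∧ r < 1 ∧ r < 2 * t := by
    obtain ⟨r, h3, h4⟩ := exists_between (show t < min 1 (2 * t) from lt_min ht1 (by linarith))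
    exact ⟨r, h3, (lt_min_iff.1 h4).1, (lt_min_iff.1 h4).2⟩
  have hrI : r ∈ Icc (0 : ℝ) 1 := ⟨by linarith, hr1.le⟩
  let q : G.Point := ⟨_, lineMap_mem_carrier h hrI⟩
  have hq : q ∈ G.shortestPath (G.node z₀) z := by
    rw [e2]
    refine Or.inr ?_
    rw [mem_ofPred_eq, hv, segment_lineMap]
    exact mem_image_of_mem _ (mem_uIcc.2 (Or.inr ⟨hrt.le, hr1.le⟩))
  rw [e1] at hq
  rcases hq with hq | hq
  · have h3 := hz₀.depth_le_of_mem hq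
    have h4 := hdep r hrI
    rcases min_le_iff.1 (h4.trans h3) with h5 | h5
    · nlinarith [mul_pos (show 0 < r by linarith) hw]
    · nlinarith [mul_pos (show 0 < 2 * t - r by linarith) hw]
  · rw [mem_ofPred_eq, hu, segment_lineMap] at hq
    obtain ⟨r', hr', hrr⟩ := hq
    have := lineMap_injective_of_adj h hrr
    rw [uIcc_of_le ht0.le] at hr'
    linarith [hr'.2]

/-- The depth grows linearly along an edge that is traversed away from the root. -/
theorem depth_lineMap {u v : G.V} (h : G.graph.Adj u v)
    (hd : depth z₀ (G.node v) = depth z₀ (G.node u) + G.w ⟨s(u, v), h⟩)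
    {t : ℝ} (ht : t ∈ Icc (0 : ℝ) 1) {z : G.Point} (hz : z.1 = AffineMap.lineMap u.1 v.1 t) :
    depth z₀ z = depth z₀ (G.node u) + t * G.w ⟨s(u, v), h⟩ := by
  have hw := G.w_pos ⟨s(u, v), h⟩
  apply le_antisymm
  · have := hz₀.depth_le_step h (left_mem_Icc.2 zero_le_one) ht (y := G.node u)
      (by rw [AffineMap.lineMap_apply_zero]; rfl) hz
    rwa [sub_zero, abs_of_nonneg ht.1] at this
  · rcases (hz₀.isPath_shortestPath z).depth_add_le h ht hz with h1 | h1
    · exact h1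
    · rw [hd] at h1
      nlinarith [ht.1, ht.2]

theorem shortestPath_lineMap {u v : G.V} (h : G.graph.Adj u v)
    (hd : depth z₀ (G.node v) = depth z₀ (G.node u) + G.w ⟨s(u, v), h⟩)
    {t : ℝ} (ht : t ∈ Icc (0 : ℝ) 1) {z : G.Point} (hz : z.1 = AffineMap.lineMap u.1 v.1 t) :
    G.shortestPath (G.node z₀) z = G.shortestPath (G.node z₀) (G.node u) ∪
      {q | ∃ r ∈ Icc 0 t, q.1 = AffineMap.lineMap u.1 v.1 r} := by
  have hu : (G.node u).1 = AffineMap.lineMap u.1 v.1 (0 : ℝ) := by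
    rw [AffineMap.lineMap_apply_zero]; rfl
  rw [hz₀.shortestPath_step h (left_mem_Icc.2 zero_le_one) ht hu hz
    (by rw [hz₀.depth_lineMap h hd ht hz, sub_zero, abs_of_nonneg ht.1]), hu, hz, segment_lineMap,
    uIcc_of_le ht.1]
  congr 1
  ext q
  simp only [mem_ofPred_eq, mem_image, eq_comm]

/-- The last non-trivial step of a shortest path to a node comes from a neighbour preceding it. -/
theorem exists_parent {v : G.V} (hv : v ≠ z₀) : ∃ (u : G.V) (h : G.graph.Adj u v),
    depth z₀ (G.node v) = depth z₀ (G.node u) + G.w ⟨s(u, v), h⟩ := by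
  have key : ∀ {z : G.Point} {S : Set G.Point} {ℓ : ℝ}, G.IsPath (G.node z₀) z S ℓ →
      z = G.node v → ℓ = depth z₀ (G.node v) → ∃ (u : G.V) (h : G.graph.Adj u v),
        depth z₀ (G.node v) = depth z₀ (G.node u) + G.w ⟨s(u, v), h⟩ := by
    intro z S ℓ hP
    induction hP with
    | refl =>
      intro h _
      exact absurd (node_injective h).symm hv
    | @step y z S ℓ u' v' h' s' t' hs' ht' hy hz' hxy ih =>
      rintro rfl hℓ
      -- After swapping its ends if necessary, the edge of the last step ends at `v`.
      have main : ∀ {u : G.V} (h : G.graph.Adj u v) {s : ℝ}, s ∈ Icc (0 : ℝ) 1 →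
          y.1 = AffineMap.lineMap u.1 v.1 s →
          ℓ + (1 - s) * G.w ⟨s(u, v), h⟩ = depth z₀ (G.node v) →
          ∃ (u : G.V) (h : G.graph.Adj u v),
            depth z₀ (G.node v) = depth z₀ (G.node u) + G.w ⟨s(u, v), h⟩ := by
        intro u h s hs hy hℓ
        have hw := G.w_pos ⟨s(u, v), h⟩
        rcases hz₀.depth_adj h with h1 | h1
        · exact ⟨u, h, h1⟩
        · have hs1 : s = 1 := by
            refine le_antisymm hs.2 ?_
            rcases hxy.depth_add_le h hs hy with h2 | h2
            · nlinarith [hs.1, hs.2]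
            · nlinarith [hs.1, hs.2]
          subst hs1
          refine ih (Subtype.ext ?_) (by linarith)
          rw [hy, AffineMap.lineMap_apply_one]; rfl
      rcases node_eq_lineMap h' ht' hz' with ⟨rfl, rfl⟩ | ⟨rfl, rfl⟩
      · refine main h'.symm (s := 1 - s') ⟨by linarith [hs'.2], by linarith [hs'.1]⟩
          (by rw [hy, AffineMap.lineMap_apply_one_sub]) ?_
        rw [w_swap h', ← hℓ, zero_sub, abs_neg, abs_of_nonneg hs'.1]
        ring
      · refine main h' hs' hy ?_
        rw [← hℓ, abs_of_nonneg (by linarith [hs'.2])]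
  exact key (hz₀.isPath_shortestPath _) rfl rfl

end IsUniquePathRoot

/-! ### Edges oriented away from the root -/

variable (z₀) in
theorem exists_ends (e : G.Edge) : ∃ p : G.V × G.V, ∃ h : G.graph.Adj p.1 p.2,
    e = ⟨s(p.1, p.2), h⟩ ∧ depth z₀ (G.node p.1) ≤ depth z₀ (G.node p.2) := by
  obtain ⟨e, he⟩ := e
  induction e using Sym2.ind with
  | _ u v =>
    rcases le_total (depth z₀ (G.node u)) (depth z₀ (G.node v)) with h | h
    · exact ⟨(u, v), he, rfl, h⟩
    · exact ⟨(v, u), SimpleGraph.Adj.symm he, Subtype.ext Sym2.eq_swap, h⟩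

variable (z₀) in
/-- The end of an edge that is nearer to the root. -/
noncomputable def tail (e : G.Edge) : G.V := (exists_ends z₀ e).choose.1

variable (z₀) in
/-- The end of an edge that is farther from the root. -/
noncomputable def head (e : G.Edge) : G.V := (exists_ends z₀ e).choose.2

theorem adj_tail_head (e : G.Edge) : G.graph.Adj (tail z₀ e) (head z₀ e) :=
  (exists_ends z₀ e).choose_spec.choose

theorem eq_tail_head (e : G.Edge) : e = ⟨s(tail z₀ e, head z₀ e), adj_tail_head e⟩ :=
  (exists_ends z₀ e).choose_spec.choose_spec.1

theorem w_tail_head (e : G.Edge) :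
    G.w ⟨s(tail z₀ e, head z₀ e), adj_tail_head e⟩ = G.w e :=
  congrArg G.w (eq_tail_head e).symm

variable (z₀) in
/-- The parametrization of an edge by `[0, 1]`, away from the root. It is extended to `ℝ` by
constants, so that it is a continuous map on the whole line. -/
noncomputable def edgePt (e : G.Edge) (t : ℝ) : G.Point :=
  ⟨AffineMap.lineMap (tail z₀ e).1 (head z₀ e).1 (projIcc (0 : ℝ) 1 zero_le_one t : ℝ),
    lineMap_mem_carrier (adj_tail_head e) (projIcc (0 : ℝ) 1 zero_le_one t).2⟩

theorem edgePt_val (e : G.Edge) {t : ℝ} (ht : t ∈ Icc (0 : ℝ) 1) :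
    (edgePt z₀ e t).1 = AffineMap.lineMap (tail z₀ e).1 (head z₀ e).1 t := by
  simp [edgePt, projIcc_of_mem _ ht]

theorem edgePt_zero (e : G.Edge) : edgePt z₀ e 0 = G.node (tail z₀ e) :=
  Subtype.ext (by
    rw [edgePt_val e (left_mem_Icc.2 zero_le_one), AffineMap.lineMap_apply_zero]; rfl)

theorem edgePt_one (e : G.Edge) : edgePt z₀ e 1 = G.node (head z₀ e) :=
  Subtype.ext (by
    rw [edgePt_val e (right_mem_Icc.2 zero_le_one), AffineMap.lineMap_apply_one]; rfl)

theorem continuous_edgePt (e : G.Edge) : Continuous (edgePt z₀ e) :=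
  Continuous.subtype_mk (AffineMap.lineMap_continuous.comp
    (continuous_subtype_val.comp continuous_projIcc)) _

theorem edgePoints_eq (e : G.Edge) : G.edgePoints e = edgePt z₀ e '' Icc 0 1 := by
  ext x
  have : G.pairSegment e.1 = segment ℝ (tail z₀ e).1 (head z₀ e).1 := by
    conv_lhs => rw [eq_tail_head (z₀ := z₀) e]
    rfl
  rw [edgePoints, mem_ofPred_eq, this, segment_eq_image_lineMap]
  constructor
  · rintro ⟨t, ht, hx⟩
    exact ⟨t, ht, Subtype.ext (by rw [edgePt_val e ht, hx])⟩
  · rintro ⟨t, ht, rfl⟩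
    exact ⟨t, ht, (edgePt_val e ht).symm⟩

theorem edgePt_injOn (e : G.Edge) : InjOn (edgePt z₀ e) (Icc 0 1) := fun s hs t ht h =>
  lineMap_injective_of_adj (adj_tail_head e) (by rw [← edgePt_val e hs, ← edgePt_val e ht, h])

/-- An interior point of an edge lies on no other edge. -/
theorem edgePt_eq_edgePt {e e' : G.Edge} {t t' : ℝ} (ht : t ∈ Ioo (0 : ℝ) 1)
    (ht' : t' ∈ Icc (0 : ℝ) 1) (h : edgePt z₀ e t = edgePt z₀ e' t') : e = e' ∧ t = t' := by
  have h' := congrArg (fun p : G.Point => p.1) h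
  simp only [edgePt_val e (Ioo_subset_Icc_self ht), edgePt_val e' ht'] at h'
  have hee : e = e' := by
    rcases lineMap_eq_cases (adj_tail_head e) (adj_tail_head e') (Ioo_subset_Icc_self ht) ht' h'
      with ⟨h1, h2, -⟩ | ⟨h1, h2, -⟩ | ⟨-, h1 | h1, -⟩
    · rw [eq_tail_head (z₀ := z₀) e, eq_tail_head (z₀ := z₀) e']
      exact Subtype.ext (by simp only [h1, h2])
    · rw [eq_tail_head (z₀ := z₀) e, eq_tail_head (z₀ := z₀) e']
      exact Subtype.ext (by simp only [h1, h2]; exact Sym2.eq_swap)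
    · exact absurd h1 ht.1.ne'
    · exact absurd h1 ht.2.ne
  subst hee
  exact ⟨rfl, edgePt_injOn e (Ioo_subset_Icc_self ht) ht' h⟩

theorem node_eq_edgePt {a : G.V} {e : G.Edge} {t : ℝ} (ht : t ∈ Icc (0 : ℝ) 1)
    (h : G.node a = edgePt z₀ e t) : (a = tail z₀ e ∧ t = 0) ∨ (a = head z₀ e ∧ t = 1) :=
  node_eq_lineMap (adj_tail_head e) ht (by rw [← edgePt_val e ht, ← h]; rfl)

theorem IsPath.isClosed {x y : G.Point} {S : Set G.Point} {ℓ : ℝ} (h : G.IsPath x y S ℓ) :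
    IsClosed S := by
  induction h with
  | refl => exact isClosed_singleton
  | step u v h s t hs ht hy hz hxy ih =>
    refine ih.union (IsClosed.preimage continuous_subtype_val ?_)
    rw [segment_eq_image_lineMap]
    exact (isCompact_Icc.image AffineMap.lineMap_continuous).isClosed

theorem mem_shortestPath_of_mem_gam {e : G.Edge} {t : ℝ} (ht : t ∈ Icc (0 : ℝ) 1) {y : G.Point}
    (h : y ∈ G.gam z₀ e) : edgePt z₀ e t ∈ G.shortestPath (G.node z₀) y :=
  h (by rw [edgePoints_eq (z₀ := z₀)]; exact mem_image_of_mem _ ht)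

namespace IsUniquePathRoot

variable (hz₀ : G.IsUniquePathRoot z₀)
include hz₀

theorem measurableSet_shortestPath (x : G.Point) :
    MeasurableSet (G.shortestPath (G.node z₀) x) :=
  (hz₀.isPath_shortestPath x).isClosed.measurableSet

theorem depth_head (e : G.Edge) :
    depth z₀ (G.node (head z₀ e)) = depth z₀ (G.node (tail z₀ e)) + G.w e := by
  have h := hz₀.depth_adj (adj_tail_head (z₀ := z₀) e)
  rw [w_tail_head] at h
  refine h.resolve_right fun h' => ?_
  linarith [G.w_pos e, show depth z₀ (G.node (tail z₀ e)) ≤ depth z₀ (G.node (head z₀ e)) from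
    (exists_ends z₀ e).choose_spec.choose_spec.2]

theorem depth_edgePt (e : G.Edge) {t : ℝ} (ht : t ∈ Icc (0 : ℝ) 1) :
    depth z₀ (edgePt z₀ e t) = depth z₀ (G.node (tail z₀ e)) + t * G.w e := by
  rw [hz₀.depth_lineMap (adj_tail_head e) (by rw [hz₀.depth_head, w_tail_head]) ht
    (edgePt_val e ht), w_tail_head]

theorem shortestPath_edgePt (e : G.Edge) {t : ℝ} (ht : t ∈ Icc (0 : ℝ) 1) :
    G.shortestPath (G.node z₀) (edgePt z₀ e t) =
      G.shortestPath (G.node z₀) (G.node (tail z₀ e)) ∪ edgePt z₀ e '' Icc 0 t := by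
  rw [hz₀.shortestPath_lineMap (adj_tail_head e) (by rw [hz₀.depth_head, w_tail_head]) ht
    (edgePt_val e ht)]
  congr 1
  ext q
  constructor
  · rintro ⟨r, hr, hq⟩
    exact ⟨r, hr, Subtype.ext (by rw [edgePt_val e ⟨hr.1, hr.2.trans ht.2⟩, hq])⟩
  · rintro ⟨r, hr, rfl⟩
    exact ⟨r, hr, edgePt_val e ⟨hr.1, hr.2.trans ht.2⟩⟩

theorem exists_head_eq {v : G.V} (hv : v ≠ z₀) : ∃ e : G.Edge, head z₀ e = v := by
  obtain ⟨u, h, hd⟩ := hz₀.exists_parent hv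
  refine ⟨⟨s(u, v), h⟩, ?_⟩
  have h1 := congrArg Subtype.val (eq_tail_head (z₀ := z₀) ⟨s(u, v), h⟩)
  have h2 := hz₀.depth_head ⟨s(u, v), h⟩
  have h3 := G.w_pos ⟨s(u, v), h⟩
  rcases Sym2.eq_iff.1 h1 with ⟨-, h4⟩ | ⟨h4, h5⟩
  · exact h4.symm
  · rw [← h4, ← h5] at h2
    linarith

/-- Induction on the nodes, away from the root. -/
theorem node_induction {p : G.V → Prop} (hroot : p z₀) (hstep : ∀ e, p (tail z₀ e) → p (head z₀ e))
    (v : G.V) : p v := by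
  by_contra hv
  obtain ⟨a, ha, hmin⟩ := (toFinite {v | ¬ p v}).exists_minimalFor
    (fun v => depth z₀ (G.node v)) _ ⟨v, hv⟩
  obtain ⟨e, rfl⟩ := hz₀.exists_head_eq (v := a) (fun h => ha (h ▸ hroot))
  refine ha (hstep e (by_contra fun hc => ?_))
  have h1 := hz₀.depth_head e
  have h2 := G.w_pos e
  have := hmin hc (by simp only; linarith)
  simp only at this
  linarith

theorem eq_root_or_edgePt (x : G.Point) :
    x = G.node z₀ ∨ ∃ e, ∃ t ∈ Icc (0 : ℝ) 1, x = edgePt z₀ e t := by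
  obtain ⟨x, hx | hx⟩ := x
  · by_cases h : (⟨x, hx⟩ : G.V) = z₀
    · exact Or.inl (congrArg G.node h)
    · obtain ⟨e, he⟩ := hz₀.exists_head_eq h
      refine Or.inr ⟨e, 1, right_mem_Icc.2 zero_le_one, ?_⟩
      rw [edgePt_one, he]; rfl
  · obtain ⟨e, he⟩ := mem_iUnion.1 hx
    have h1 : (⟨x, Or.inr hx⟩ : G.Point) ∈ G.edgePoints e := he
    rw [edgePoints_eq (z₀ := z₀)] at h1
    obtain ⟨t, ht, h⟩ := h1
    exact Or.inr ⟨e, t, ht, h.symm⟩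

theorem self_mem (x : G.Point) : x ∈ G.shortestPath (G.node z₀) x := by
  rcases hz₀.eq_root_or_edgePt x with rfl | ⟨e, t, ht, rfl⟩
  · rw [hz₀.shortestPath_root]; rfl
  · rw [hz₀.shortestPath_edgePt e ht]
    exact Or.inr (mem_image_of_mem _ (right_mem_Icc.2 ht.1))

theorem shortestPath_subset {x y : G.Point} (h : x ∈ G.shortestPath (G.node z₀) y) :
    G.shortestPath (G.node z₀) x ⊆ G.shortestPath (G.node z₀) y := by
  have hedge : ∀ (e : G.Edge) (t : ℝ), t ∈ Icc (0 : ℝ) 1 →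
      (∀ x ∈ G.shortestPath (G.node z₀) (G.node (tail z₀ e)), G.shortestPath (G.node z₀) x ⊆
        G.shortestPath (G.node z₀) (G.node (tail z₀ e))) →
      ∀ x ∈ G.shortestPath (G.node z₀) (edgePt z₀ e t), G.shortestPath (G.node z₀) x ⊆
        G.shortestPath (G.node z₀) (edgePt z₀ e t) := by
    intro e t ht ih x hx
    rw [hz₀.shortestPath_edgePt e ht] at hx ⊢
    rcases hx with hx | ⟨r, hr, rfl⟩
    · exact (ih x hx).trans subset_union_left
    · rw [hz₀.shortestPath_edgePt e ⟨hr.1, hr.2.trans ht.2⟩]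
      exact union_subset_union_right _ (image_mono (Icc_subset_Icc_right hr.2))
  have hnode : ∀ v : G.V, ∀ x ∈ G.shortestPath (G.node z₀) (G.node v),
      G.shortestPath (G.node z₀) x ⊆ G.shortestPath (G.node z₀) (G.node v) := by
    refine hz₀.node_induction ?_ fun e ih => ?_
    · intro x hx
      rw [hz₀.shortestPath_root, mem_singleton_iff] at hx
      rw [hx]
    · rw [← edgePt_one]
      exact hedge e 1 (right_mem_Icc.2 zero_le_one) ih
  rcases hz₀.eq_root_or_edgePt y with rfl | ⟨e, t, ht, rfl⟩
  · exact hnode _ x h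
  · exact hedge e t ht (hnode _) x h

theorem edgePt_mem_shortestPath_edgePt (e : G.Edge) {s t : ℝ} (hs : 0 ≤ s) (hst : s ≤ t)
    (ht : t ≤ 1) : edgePt z₀ e s ∈ G.shortestPath (G.node z₀) (edgePt z₀ e t) := by
  rw [hz₀.shortestPath_edgePt e ⟨hs.trans hst, ht⟩]
  exact Or.inr (mem_image_of_mem _ ⟨hs, hst⟩)

theorem tail_mem (e : G.Edge) {t : ℝ} (ht : t ∈ Icc (0 : ℝ) 1) :
    G.node (tail z₀ e) ∈ G.shortestPath (G.node z₀) (edgePt z₀ e t) := by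
  rw [← edgePt_zero]
  exact hz₀.edgePt_mem_shortestPath_edgePt e le_rfl ht.1 ht.2

/-- A shortest path contains an edge as soon as it contains its far end. -/
theorem mem_gam_iff {e : G.Edge} {y : G.Point} :
    y ∈ G.gam z₀ e ↔ G.node (head z₀ e) ∈ G.shortestPath (G.node z₀) y := by
  rw [gam, mem_ofPred_eq, edgePoints_eq (z₀ := z₀)]
  constructor
  · intro h
    rw [← edgePt_one]
    exact h (mem_image_of_mem _ (right_mem_Icc.2 zero_le_one))
  · rintro h _ ⟨t, ht, rfl⟩
    refine hz₀.shortestPath_subset h ?_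
    rw [← edgePt_one]
    exact hz₀.edgePt_mem_shortestPath_edgePt e ht.1 ht.2 le_rfl

/-- A shortest path to a node contains an interior point of an edge only if it contains the
whole edge. -/
theorem node_mem_gam_iff {e : G.Edge} {t : ℝ} (ht : t ∈ Ioo (0 : ℝ) 1) (a : G.V) :
    G.node a ∈ G.gam z₀ e ↔ edgePt z₀ e t ∈ G.shortestPath (G.node z₀) (G.node a) := by
  refine ⟨mem_shortestPath_of_mem_gam (Ioo_subset_Icc_self ht), ?_⟩
  induction a using hz₀.node_induction with
  | hroot =>
    intro h
    have h1 := hz₀.depth_le_of_mem h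
    rw [depth_root, hz₀.depth_edgePt e (Ioo_subset_Icc_self ht)] at h1
    have h2 := depth_nonneg (z₀ := z₀) (G.node (tail z₀ e))
    linarith [mul_pos ht.1 (G.w_pos e)]
  | hstep e' ih =>
    intro h
    have h11 : (1 : ℝ) ∈ Icc (0 : ℝ) 1 := right_mem_Icc.2 zero_le_one
    rw [← edgePt_one, hz₀.shortestPath_edgePt e' h11] at h
    rcases h with h | ⟨r, hr, h⟩
    · rw [hz₀.mem_gam_iff, ← edgePt_one (e := e')]
      exact hz₀.shortestPath_subset (hz₀.tail_mem e' h11) (hz₀.mem_gam_iff.1 (ih h))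
    · obtain ⟨rfl, -⟩ := edgePt_eq_edgePt ht hr h.symm
      exact hz₀.mem_gam_iff.2 (hz₀.self_mem _)

/-- The interior points of edges that a shortest path passes through: those of the edges traversed
on the way to the tail of the last edge, and those of an initial piece of the last edge. -/
theorem edgePt_mem_shortestPath_iff {e e' : G.Edge} {t t' : ℝ} (ht : t ∈ Ioo (0 : ℝ) 1)
    (ht' : t' ∈ Icc (0 : ℝ) 1) :
    edgePt z₀ e t ∈ G.shortestPath (G.node z₀) (edgePt z₀ e' t') ↔
      G.node (tail z₀ e') ∈ G.gam z₀ e ∨ (e = e' ∧ t ≤ t') := by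
  rw [hz₀.shortestPath_edgePt e' ht', mem_union, ← hz₀.node_mem_gam_iff ht]
  refine or_congr_right ⟨?_, ?_⟩
  · rintro ⟨r, hr, h⟩
    obtain ⟨rfl, rfl⟩ := edgePt_eq_edgePt ht ⟨hr.1, hr.2.trans ht'.2⟩ h.symm
    exact ⟨rfl, hr.2⟩
  · rintro ⟨rfl, h⟩
    exact mem_image_of_mem _ ⟨ht.1.le, h⟩

theorem edgePt_notMem_gam {e : G.Edge} {t : ℝ} (ht : t ∈ Ico (0 : ℝ) 1) :
    edgePt z₀ e t ∉ G.gam z₀ e := by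
  intro h
  have h1 := hz₀.depth_le_of_mem (hz₀.mem_gam_iff.1 h)
  rw [hz₀.depth_edgePt e (Ico_subset_Icc_self ht), hz₀.depth_head] at h1
  nlinarith [G.w_pos e, ht.2]

theorem tail_notMem_gam (e : G.Edge) : G.node (tail z₀ e) ∉ G.gam z₀ e := by
  rw [← edgePt_zero]
  exact hz₀.edgePt_notMem_gam ⟨le_rfl, one_pos⟩

/-- What lies behind an interior point of an edge: the rest of the edge and what lies behind the
edge. -/
theorem Lam_edgePt {e : G.Edge} {t : ℝ} (ht : t ∈ Ioo (0 : ℝ) 1) :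
    G.Lam z₀ (edgePt z₀ e t) = edgePt z₀ e '' Icc t 1 ∪ G.gam z₀ e := by
  ext y
  constructor
  · intro h
    change edgePt z₀ e t ∈ G.shortestPath (G.node z₀) y at h
    rcases hz₀.eq_root_or_edgePt y with rfl | ⟨e', t', ht', rfl⟩
    · exact Or.inr ((hz₀.node_mem_gam_iff ht z₀).2 h)
    · rcases (hz₀.edgePt_mem_shortestPath_iff ht ht').1 h with h' | ⟨rfl, h'⟩
      · exact Or.inr (hz₀.mem_gam_iff.2
          (hz₀.shortestPath_subset (hz₀.tail_mem e' ht') (hz₀.mem_gam_iff.1 h')))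
      · exact Or.inl (mem_image_of_mem _ ⟨h', ht'.2⟩)
  · rintro (⟨s, hs, rfl⟩ | h)
    · exact hz₀.edgePt_mem_shortestPath_edgePt e ht.1.le hs.1 hs.2
    · exact mem_shortestPath_of_mem_gam (Ioo_subset_Icc_self ht) h

end IsUniquePathRoot

/-! ### The length measure -/

variable (G) in
theorem measurableSet_carrier : MeasurableSet G.carrier := by
  refine G.V.finite_toSet.measurableSet.union (MeasurableSet.iUnion fun e => ?_)
  obtain ⟨e, he⟩ := e
  induction e using Sym2.ind with
  | _ u v =>
    change MeasurableSet (segment ℝ u.1 v.1)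
    rw [segment_eq_image_lineMap]
    exact (isCompact_Icc.image AffineMap.lineMap_continuous).isClosed.measurableSet

variable (z₀) in
theorem lengthMeasure_eq_sum : G.lengthMeasure =
    ∑ e : G.Edge, ENNReal.ofReal (G.w e) • (volume.restrict (Ioo (0 : ℝ) 1)).map (edgePt z₀ e) := by
  have hemb := MeasurableEmbedding.subtype_coe G.measurableSet_carrier
  have hpair : ∀ e : G.Edge, G.pairMeasure e.1 = (volume.restrict (Icc (0 : ℝ) 1)).map
      (AffineMap.lineMap (tail z₀ e).1 (head z₀ e).1) := by
    intro e
    conv_lhs => rw [eq_tail_head (z₀ := z₀) e]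
    rfl
  ext s hs
  rw [lengthMeasure, hemb.comap_apply, Measure.finsetSum_apply, Measure.finsetSum_apply]
  refine Finset.sum_congr rfl fun e _ => ?_
  rw [Measure.smul_apply, Measure.smul_apply, hpair, Measure.map_apply
    AffineMap.lineMap_continuous.measurable (hemb.measurableSet_image.2 hs),
    Measure.map_apply (continuous_edgePt e).measurable hs,
    restrict_Ioo_eq_restrict_Icc,
    Measure.restrict_apply' measurableSet_Icc, Measure.restrict_apply' measurableSet_Icc]
  congr 2
  ext t
  refine and_congr_left fun ht => ?_
  rw [mem_preimage, mem_preimage, ← edgePt_val e ht, mem_image]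
  exact ⟨fun ⟨x, hx, h⟩ => Subtype.ext h ▸ hx, fun h => ⟨_, h, rfl⟩⟩

instance : IsFiniteMeasure G.lengthMeasure := by
  obtain ⟨z₀⟩ := G.connected.nonempty
  rw [lengthMeasure_eq_sum z₀]
  refine ⟨?_⟩
  rw [Measure.finsetSum_apply]
  refine ENNReal.sum_lt_top.2 fun e _ => ?_
  rw [Measure.smul_apply]
  exact ENNReal.mul_lt_top ENNReal.ofReal_lt_top (measure_lt_top _ _)

theorem integral_lengthMeasure {f : G.Point → ℝ} (hf : Integrable f G.lengthMeasure) :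
    ∫ x, f x ∂G.lengthMeasure =
      ∑ e : G.Edge, G.w e * ∫ t in Ioo (0 : ℝ) 1, f (edgePt z₀ e t) := by
  rw [lengthMeasure_eq_sum z₀] at hf ⊢
  have hf' := integrable_finsetSum_measure.1 hf
  rw [integral_finsetSum_measure hf']
  refine Finset.sum_congr rfl fun e he => ?_
  rw [integral_smul_measure, ENNReal.toReal_ofReal (G.w_pos e).le, smul_eq_mul, integral_map
    (continuous_edgePt e).aemeasurable]
  refine AEStronglyMeasurable.mono_ac ?_ (hf' e he).aestronglyMeasurable
  exact Measure.absolutelyContinuous_smul (by simpa using G.w_pos e)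

theorem integrable_comp_edgePt {f : G.Point → ℝ} (hf : Integrable f G.lengthMeasure)
    (e : G.Edge) : IntegrableOn (fun t => f (edgePt z₀ e t)) (Ioo 0 1) := by
  rw [lengthMeasure_eq_sum z₀] at hf
  have hf' := integrable_finsetSum_measure.1 hf e (Finset.mem_univ e)
  rw [integrable_smul_measure (by simpa using G.w_pos e) ENNReal.ofReal_ne_top] at hf'
  exact hf'.comp_measurable (continuous_edgePt e).measurable

theorem lengthMeasure_range_node : G.lengthMeasure (range G.node) = 0 := by
  obtain ⟨z₀⟩ := G.connected.nonempty
  rw [lengthMeasure_eq_sum z₀, Measure.finsetSum_apply]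
  refine Finset.sum_eq_zero fun e _ => ?_
  have hm : MeasurableSet (range G.node) := (finite_range _).measurableSet
  rw [Measure.smul_apply, Measure.map_apply (continuous_edgePt e).measurable hm,
    Measure.restrict_apply' measurableSet_Ioo]
  convert smul_zero _
  convert measure_empty (μ := volume)
  refine eq_empty_of_forall_notMem ?_
  rintro t ⟨⟨a, ha⟩, ht⟩
  rcases node_eq_edgePt (Ioo_subset_Icc_self ht) ha with h | h
  · exact ht.1.ne' h.2
  · exact ht.2.ne h.2

/-- The coordinate of a point along an edge: the inverse of `edgePt`, extended continuously to the
whole graph. -/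
noncomputable def coord (z₀ : G.V) (e : G.Edge) (x : G.Point) : ℝ :=
  dist (tail z₀ e).1 x.1 / dist (tail z₀ e).1 (head z₀ e).1

theorem measurable_coord (e : G.Edge) : Measurable (coord z₀ e) :=
  ((continuous_const.dist continuous_subtype_val).div_const _).measurable

theorem coord_edgePt (e : G.Edge) {t : ℝ} (ht : t ∈ Icc (0 : ℝ) 1) :
    coord z₀ e (edgePt z₀ e t) = t := by
  have : dist (tail z₀ e).1 (head z₀ e).1 ≠ 0 :=
    dist_ne_zero.2 fun h => (adj_tail_head e).ne (Subtype.ext h)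
  rw [coord, edgePt_val e ht, dist_left_lineMap, Real.norm_of_nonneg ht.1,
    mul_div_cancel_right₀ _ this]

/-- The function on the graph that is given on every edge, away from the nodes, by a function of
the coordinate along the edge. (At a node, where the values on the edges may disagree, it is the
sum of the values on the edges that end there.) -/
noncomputable def glue (z₀ : G.V) (φ : G.Edge → ℝ → ℝ) (x : G.Point) : ℝ :=
  ∑ e : G.Edge, (edgePt z₀ e '' Icc 0 1).indicator (fun x => φ e (coord z₀ e x)) x

theorem measurableSet_image_edgePt (e : G.Edge) (a b : ℝ) :
    MeasurableSet (edgePt z₀ e '' Icc a b) :=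
  (isCompact_Icc.image (continuous_edgePt e)).isClosed.measurableSet

theorem measurable_glue {φ : G.Edge → ℝ → ℝ} (hφ : ∀ e, Measurable (φ e)) :
    Measurable (glue z₀ φ) :=
  Finset.measurable_sum _ fun e _ =>
    ((hφ e).comp (measurable_coord e)).indicator (measurableSet_image_edgePt e 0 1)

theorem glue_edgePt (φ : G.Edge → ℝ → ℝ) (e : G.Edge) {t : ℝ} (ht : t ∈ Ioo (0 : ℝ) 1) :
    glue z₀ φ (edgePt z₀ e t) = φ e t := by
  have htI := Ioo_subset_Icc_self ht
  rw [glue, Finset.sum_eq_single e, indicator_of_mem (mem_image_of_mem _ htI), coord_edgePt e htI]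
  · intro e' _ hne
    refine indicator_of_notMem ?_ _
    rintro ⟨r, hr, h⟩
    exact hne (edgePt_eq_edgePt ht hr h.symm).1.symm
  · exact fun h => absurd (Finset.mem_univ e) h

theorem abs_glue_le {φ : G.Edge → ℝ → ℝ} {C : G.Edge → ℝ}
    (hC : ∀ e, ∀ t ∈ Icc (0 : ℝ) 1, |φ e t| ≤ C e) (x : G.Point) :
    |glue z₀ φ x| ≤ ∑ e, C e := by
  refine (Finset.abs_sum_le_sum_abs _ _).trans (Finset.sum_le_sum fun e _ => ?_)
  by_cases hx : x ∈ edgePt z₀ e '' Icc 0 1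
  · obtain ⟨t, ht, rfl⟩ := hx
    rw [indicator_of_mem (mem_image_of_mem _ ht), coord_edgePt e ht]
    exact hC e t ht
  · rw [indicator_of_notMem hx, abs_zero]
    exact (abs_nonneg _).trans (hC e 0 (left_mem_Icc.2 zero_le_one))

namespace IsUniquePathRoot

variable (hz₀ : G.IsUniquePathRoot z₀)
include hz₀

/-- The nodes being a null set, a property holds almost everywhere if it holds at all interior
points of edges. -/
theorem ae_lengthMeasure {p : G.Point → Prop}
    (hp : ∀ e, ∀ t ∈ Ioo (0 : ℝ) 1, p (edgePt z₀ e t)) : ∀ᵐ x ∂G.lengthMeasure, p x := by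
  refine measure_mono_null (fun x hx => ?_) G.lengthMeasure_range_node
  rcases hz₀.eq_root_or_edgePt x with rfl | ⟨e, t, ht, rfl⟩
  · exact mem_range_self _
  · by_contra hc
    refine hx (hp e t ⟨lt_of_le_of_ne ht.1 ?_, lt_of_le_of_ne ht.2 ?_⟩)
    · rintro rfl
      exact hc ⟨_, (edgePt_zero e).symm⟩
    · rintro rfl
      exact hc ⟨_, (edgePt_one e).symm⟩

omit hz₀ in
theorem lengthMeasure_image_edgePt (e : G.Edge) {t : ℝ} (ht : t ∈ Ioo (0 : ℝ) 1) :
    G.lengthMeasure (edgePt z₀ e '' Icc t 1) = ENNReal.ofReal ((1 - t) * G.w e) := by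
  have hm := measurableSet_image_edgePt (z₀ := z₀) e t 1
  have hpre : ∀ e', (volume.restrict (Ioo (0 : ℝ) 1)).map (edgePt z₀ e') (edgePt z₀ e '' Icc t 1) =
      volume (edgePt z₀ e' ⁻¹' (edgePt z₀ e '' Icc t 1) ∩ Ioo 0 1) := fun e' => by
    rw [Measure.map_apply (continuous_edgePt e').measurable hm,
      Measure.restrict_apply' measurableSet_Ioo]
  rw [lengthMeasure_eq_sum z₀, Measure.finsetSum_apply, Finset.sum_eq_single e]
  · rw [Measure.smul_apply, hpre, smul_eq_mul, mul_comm (1 - t), ENNReal.ofReal_mul (G.w_pos e).le,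
      ← Real.volume_Ico]
    congr 2
    ext s
    constructor
    · rintro ⟨⟨r, hr, h⟩, hs⟩
      obtain ⟨-, rfl⟩ := edgePt_eq_edgePt hs ⟨ht.1.le.trans hr.1, hr.2⟩ h.symm
      exact ⟨hr.1, hs.2⟩
    · rintro ⟨h1, h2⟩
      exact ⟨mem_image_of_mem _ ⟨h1, h2.le⟩, ht.1.trans_le h1, h2⟩
  · intro e' _ hne
    rw [Measure.smul_apply, hpre]
    convert smul_zero _
    convert measure_empty (μ := volume)
    refine eq_empty_of_forall_notMem ?_
    rintro s ⟨⟨r, hr, h⟩, hs⟩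
    exact hne (edgePt_eq_edgePt hs ⟨ht.1.le.trans hr.1, hr.2⟩ h.symm).1
  · exact fun h => absurd (Finset.mem_univ e) h

/-- The weight at an interior point of an edge is affine in the coordinate along the edge. -/
theorem weight_edgePt (e : G.Edge) {t : ℝ} (ht : t ∈ Ioo (0 : ℝ) 1) :
    G.weight z₀ G.lengthMeasure (edgePt z₀ e t) =
      ENNReal.ofReal (1 + G.lengthMeasure.real (G.gam z₀ e) + (1 - t) * G.w e) := by
  have h1 : 0 ≤ (1 - t) * G.w e := mul_nonneg (by linarith [ht.2]) (G.w_pos e).le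
  have hdisj : AEDisjoint G.lengthMeasure (G.gam z₀ e) (edgePt z₀ e '' Icc t 1) := by
    refine measure_mono_null ?_ G.lengthMeasure_range_node
    rintro _ ⟨hx, s, hs, rfl⟩
    have : s = 1 := by
      by_contra hne
      exact hz₀.edgePt_notMem_gam ⟨ht.1.le.trans hs.1, lt_of_le_of_ne hs.2 hne⟩ hx
    exact ⟨_, by rw [this, edgePt_one]⟩
  rw [weight, hz₀.Lam_edgePt ht, union_comm, measure_union₀
    (measurableSet_image_edgePt e t 1).nullMeasurableSet hdisj, lengthMeasure_image_edgePt e ht,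
    ENNReal.ofReal_add (by positivity) h1, ENNReal.ofReal_add zero_le_one measureReal_nonneg,
    ENNReal.ofReal_one, ofReal_measureReal, add_assoc]

/-- The integral over a shortest path, as a sum over the edges it contains entirely and the last
edge. -/
theorem setIntegral_shortestPath_edgePt {h : G.Point → ℝ} (hh : Integrable h G.lengthMeasure)
    (e' : G.Edge) {t' : ℝ} (ht' : t' ∈ Icc (0 : ℝ) 1) :
    ∫ y in G.shortestPath (G.node z₀) (edgePt z₀ e' t'), h y ∂G.lengthMeasure =
      ∫ y in G.shortestPath (G.node z₀) (G.node (tail z₀ e')), h y ∂G.lengthMeasure +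
        G.w e' * ∫ t in (0 : ℝ)..t', h (edgePt z₀ e' t) := by
  classical
  have hm := hz₀.measurableSet_shortestPath
  rw [← integral_indicator (hm _), ← integral_indicator (hm _),
    integral_lengthMeasure (z₀ := z₀) (hh.indicator (hm _)),
    integral_lengthMeasure (z₀ := z₀) (hh.indicator (hm _)),
    ← Finset.add_sum_erase _ _ (Finset.mem_univ e'),
    ← Finset.add_sum_erase _ _ (Finset.mem_univ e'), add_right_comm]
  congr 1
  · rw [← mul_add]
    congr 1
    have h0 : ∀ t ∈ Ioo (0 : ℝ) 1, (G.shortestPath (G.node z₀) (G.node (tail z₀ e'))).indicator h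
        (edgePt z₀ e' t) = 0 := fun t ht => indicator_of_notMem
      (fun hc => hz₀.tail_notMem_gam e' ((hz₀.node_mem_gam_iff ht _).2 hc)) _
    have h1 : ∀ t ∈ Ioo (0 : ℝ) 1, (G.shortestPath (G.node z₀) (edgePt z₀ e' t')).indicator h
        (edgePt z₀ e' t) = (Iic t').indicator (fun t => h (edgePt z₀ e' t)) t := fun t ht => by
      simp only [indicator, hz₀.edgePt_mem_shortestPath_iff ht ht', hz₀.tail_notMem_gam, mem_Iic,
        true_and, false_or]
    rw [setIntegral_congr_fun measurableSet_Ioo h0, setIntegral_congr_fun measurableSet_Ioo h1,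
      integral_zero, zero_add, setIntegral_indicator measurableSet_Iic,
      intervalIntegral.integral_of_le ht'.1]
    have hae : (Ioo 0 1 ∩ Iic t' : Set ℝ) =ᵐ[volume] (Ioc 0 1 ∩ Iic t' : Set ℝ) :=
      Ioo_ae_eq_Ioc.inter (ae_eq_refl _)
    rw [setIntegral_congr_set hae, Ioc_inter_Iic, min_eq_right ht'.2]
  · refine Finset.sum_congr rfl fun e he => ?_
    congr 1
    refine setIntegral_congr_fun measurableSet_Ioo fun t ht => ?_
    simp only [indicator, hz₀.edgePt_mem_shortestPath_iff ht ht', ← hz₀.node_mem_gam_iff ht,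
      (Finset.mem_erase.1 he).1, false_and, or_false]

theorem setIntegral_shortestPath_node {h : G.Point → ℝ} (hh : Integrable h G.lengthMeasure)
    (v : G.V) : ∫ y in G.shortestPath (G.node z₀) (G.node v), h y ∂G.lengthMeasure =
      ∑ e : G.Edge, (G.gam z₀ e).indicator 1 (G.node v) *
        (G.w e * ∫ t in Ioo (0 : ℝ) 1, h (edgePt z₀ e t)) := by
  have hm := hz₀.measurableSet_shortestPath
  rw [← integral_indicator (hm _), integral_lengthMeasure (z₀ := z₀) (hh.indicator (hm _))]
  refine Finset.sum_congr rfl fun e _ => ?_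
  rw [mul_left_comm]
  congr 1
  rw [← integral_const_mul]
  refine setIntegral_congr_fun measurableSet_Ioo fun t ht => ?_
  by_cases hv : G.node v ∈ G.gam z₀ e
  · simp [hv, indicator_of_mem ((hz₀.node_mem_gam_iff ht v).1 hv)]
  · simp [hv, indicator_of_notMem (mt (hz₀.node_mem_gam_iff ht v).2 hv)]

/-- A function on the graph is continuous if it is continuous along every edge, as the graph is a
quotient of the disjoint union of its edges (and its root). -/
theorem continuous_of_edgePt {f : G.Point → ℝ}
    (hf : ∀ e, ContinuousOn (fun t => f (edgePt z₀ e t)) (Icc 0 1)) : Continuous f := by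
  let q : (Σ _ : G.Edge, Icc (0 : ℝ) 1) ⊕ Unit → G.Point :=
    Sum.elim (fun p => edgePt z₀ p.1 p.2) fun _ => G.node z₀
  have hq : Continuous q := (continuous_sigma fun e =>
    (continuous_edgePt e).comp continuous_subtype_val).sumElim continuous_const
  have hsurj : Function.Surjective q := fun x => by
    rcases hz₀.eq_root_or_edgePt x with rfl | ⟨e, t, ht, rfl⟩
    · exact ⟨Sum.inr (), rfl⟩
    · exact ⟨Sum.inl ⟨e, t, ht⟩, rfl⟩
  rw [(hq.isClosedMap.isQuotientMap hq hsurj).continuous_iff, continuous_sum_dom]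
  exact ⟨continuous_sigma fun e => (hf e).domRestrict,
    continuous_of_discreteTopology⟩

/-- Integration along shortest paths turns an integrable function into the graph derivative of a
continuous function. -/
theorem continuous_setIntegral_shortestPath {h : G.Point → ℝ}
    (hh : Integrable h G.lengthMeasure) :
    Continuous fun x => ∫ y in G.shortestPath (G.node z₀) x, h y ∂G.lengthMeasure := by
  refine hz₀.continuous_of_edgePt fun e => ?_
  refine ContinuousOn.congr ?_ fun t ht => hz₀.setIntegral_shortestPath_edgePt hh e ht
  refine continuousOn_const.add (continuousOn_const.mul ?_)
  have hi : IntegrableOn (fun t => h (edgePt z₀ e t)) (uIcc 0 1) := by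
    rw [uIcc_of_le zero_le_one, integrableOn_Icc_iff_integrableOn_Ioo]
    exact integrable_comp_edgePt hh e
  have := intervalIntegral.continuousOn_primitive_interval hi
  rwa [uIcc_of_le zero_le_one] at this

end IsUniquePathRoot

/-! ### Measures supported on the nodes -/

section Nodes

variable {μ : Measure G.Point} [IsFiniteMeasure μ] (hμ : μ (range G.node)ᶜ = 0)
include hμ

theorem integral_eq_sum_node (f : G.Point → ℝ) :
    ∫ x, f x ∂μ = ∑ v : G.V, μ.real {G.node v} * f (G.node v) := by
  have h1 : ∫ x, f x ∂μ = ∫ x in (Finset.univ.map ⟨G.node, node_injective⟩ : Finset G.Point),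
      f x ∂μ := by
    rw [Measure.restrict_eq_self_of_ae_mem]
    refine measure_mono_null ?_ hμ
    rintro x hx ⟨v, rfl⟩
    exact hx (Finset.mem_map_of_mem _ (Finset.mem_univ v))
  rw [h1, setIntegral_finset _ IntegrableOn.finset, Finset.sum_map]
  rfl

theorem measureReal_eq_sum_node (S : Set G.Point) :
    μ.real S = ∑ v : G.V, μ.real {G.node v} * S.indicator 1 (G.node v) := by
  have hfin : MeasurableSet (S ∩ range G.node) :=
    ((finite_range G.node).subset inter_subset_right).measurableSet
  have h1 : μ.real S = μ.real (S ∩ range G.node) := by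
    refine measureReal_congr ?_
    have h2 : range G.node =ᵐ[μ] univ := by rwa [ae_eq_univ]
    simpa using ((ae_eq_refl S).inter h2).symm
  rw [h1, ← integral_indicator_one hfin, integral_eq_sum_node hμ]
  refine Finset.sum_congr rfl fun v _ => ?_
  congr 1
  by_cases hv : G.node v ∈ S
  · rw [indicator_of_mem hv,
      indicator_of_mem (show _ ∈ S ∩ range G.node from ⟨hv, mem_range_self v⟩)]
  · rw [indicator_of_notMem hv, indicator_of_notMem fun h => hv h.1]

end Nodes

/-! ### The weighted length measure -/

variable (z₀) in
/-- The weight along an edge, as a function of the coordinate away from the root. -/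
noncomputable def edgeDensity (e : G.Edge) (t : ℝ) : ℝ :=
  1 + G.lengthMeasure.real (G.gam z₀ e) + (1 - t) * G.w e

theorem one_le_edgeDensity (e : G.Edge) {t : ℝ} (ht : t ≤ 1) : 1 ≤ edgeDensity z₀ e t := by
  have h1 : 0 ≤ (1 - t) * G.w e := mul_nonneg (by linarith) (G.w_pos e).le
  have h2 : 0 ≤ G.lengthMeasure.real (G.gam z₀ e) := measureReal_nonneg
  rw [edgeDensity]; linarith

theorem measurable_edgeDensity (e : G.Edge) : Measurable (edgeDensity z₀ e) := by
  unfold edgeDensity; fun_prop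

/-- The number `β_e` is the integral of `ŵ ^ (1 - p)` over the edge `e`. -/
theorem edgeWeight_eq_integral (e : G.Edge) (p : ℝ) :
    G.edgeWeight z₀ p e = G.w e * ∫ t in Ioo (0 : ℝ) 1, edgeDensity z₀ e t ^ (1 - p) := by
  have hw := G.w_pos e
  have ha : 0 < 1 + G.lengthMeasure.real (G.gam z₀ e) := by
    have : 0 ≤ G.lengthMeasure.real (G.gam z₀ e) := measureReal_nonneg
    linarith
  rw [edgeWeight]
  simp only [edgeDensity]
  generalize 1 + G.lengthMeasure.real (G.gam z₀ e) = a at ha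
  generalize G.w e = w at hw
  have h1 : w * ∫ t in Ioo (0 : ℝ) 1, (a + (1 - t) * w) ^ (1 - p) =
      ∫ x in a..a + w, x ^ (1 - p) := by
    rw [← integral_Ioc_eq_integral_Ioo, ← intervalIntegral.integral_of_le zero_le_one]
    have := intervalIntegral.mul_integral_comp_sub_mul (a := 0) (b := 1)
      (f := fun x : ℝ => x ^ (1 - p)) w (a + w)
    rw [mul_one, mul_zero, sub_zero, add_sub_cancel_right] at this
    rw [← this]
    congr 2 with t
    congr 1
    ring
  rw [h1]
  split_ifs with hp
  · subst hp
    have : ∀ x : ℝ, x ^ (1 - 2 : ℝ) = x⁻¹ := fun x => by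
      rw [← Real.rpow_neg_one]; norm_num
    simp_rw [this]
    rw [integral_inv_of_pos ha (by linarith), add_div, div_self ha.ne']
  · have h0 : (0 : ℝ) ∉ uIcc a (a + w) := by
      rw [uIcc_of_le (by linarith)]
      exact fun h => absurd h.1 (not_le.2 ha)
    rw [integral_rpow (Or.inr ⟨fun h => hp (by linarith), h0⟩)]
    congr 2 <;> ring_nf

theorem isFiniteMeasure_withDensity_weight :
    IsFiniteMeasure (G.lengthMeasure.withDensity (G.weight z₀ G.lengthMeasure)) := by
  refine isFiniteMeasure_withDensity (ne_top_of_le_ne_top ?_ (lintegral_mono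
    (g := fun _ => 1 + G.lengthMeasure univ) fun x => ?_))
  · rw [lintegral_const]
    exact ENNReal.mul_ne_top (by simp) (measure_ne_top _ _)
  · exact add_le_add_right (measure_mono (subset_univ _)) _

namespace IsUniquePathRoot

variable (hz₀ : G.IsUniquePathRoot z₀)
include hz₀

theorem integral_withDensity_weight {k : G.Point → ℝ} (hk : Integrable k G.lengthMeasure) :
    ∫ x, k x ∂(G.lengthMeasure.withDensity (G.weight z₀ G.lengthMeasure)) =
      ∑ e : G.Edge, G.w e *
        ∫ t in Ioo (0 : ℝ) 1, edgeDensity z₀ e t * k (edgePt z₀ e t) := by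
  have hm := measurable_glue (z₀ := z₀) (measurable_edgeDensity (z₀ := z₀))
  have hae : G.weight z₀ G.lengthMeasure =ᵐ[G.lengthMeasure]
      fun x => ENNReal.ofReal (glue z₀ (edgeDensity z₀) x) :=
    hz₀.ae_lengthMeasure fun e t ht => by
      simp only [hz₀.weight_edgePt e ht, glue_edgePt _ e ht, edgeDensity]
  have hpos : ∀ᵐ x ∂G.lengthMeasure, 0 ≤ glue z₀ (edgeDensity z₀) x :=
    hz₀.ae_lengthMeasure fun e t ht => by
      rw [glue_edgePt _ e ht]
      exact zero_le_one.trans (one_le_edgeDensity e ht.2.le)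
  have hbd := abs_glue_le (z₀ := z₀) (φ := edgeDensity z₀) (C := fun e => edgeDensity z₀ e 0)
    fun e t ht => by
      rw [abs_of_nonneg (zero_le_one.trans (one_le_edgeDensity e ht.2)), edgeDensity, edgeDensity]
      nlinarith [ht.1, G.w_pos e]
  rw [withDensity_congr_ae hae, integral_withDensity_eq_integral_toReal_smul hm.ennreal_ofReal
    (ae_of_all _ fun x => ENNReal.ofReal_lt_top)]
  have h1 : ∫ x, (ENNReal.ofReal (glue z₀ (edgeDensity z₀) x)).toReal • k x ∂G.lengthMeasure =
      ∫ x, glue z₀ (edgeDensity z₀) x * k x ∂G.lengthMeasure := by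
    refine integral_congr_ae ?_
    filter_upwards [hpos] with x hx
    rw [ENNReal.toReal_ofReal hx, smul_eq_mul]
  rw [h1, integral_lengthMeasure (z₀ := z₀)
    (hk.bdd_mul hm.aestronglyMeasurable (ae_of_all _ hbd))]
  refine Finset.sum_congr rfl fun e _ => ?_
  congr 1
  refine setIntegral_congr_fun measurableSet_Ioo fun t ht => ?_
  simp only [glue_edgePt _ e ht]

/-- Summation by parts: the difference of the integrals of a function pairs its graph derivative
with the differences of the masses behind the edges. -/
theorem integral_sub_integral {μ ν : Measure G.Point} [IsFiniteMeasure μ] [IsFiniteMeasure ν]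
    (hμ : μ (range G.node)ᶜ = 0) (hν : ν (range G.node)ᶜ = 0) {f h : G.Point → ℝ}
    (hh : Integrable h G.lengthMeasure)
    (hf : ∀ v, f (G.node v) =
      ∫ y in G.shortestPath (G.node z₀) (G.node v), h y ∂G.lengthMeasure) :
    ∫ x, f x ∂μ - ∫ x, f x ∂ν = ∑ e : G.Edge, (μ.real (G.gam z₀ e) - ν.real (G.gam z₀ e)) *
      (G.w e * ∫ t in Ioo (0 : ℝ) 1, h (edgePt z₀ e t)) := by
  rw [integral_eq_sum_node hμ, integral_eq_sum_node hν, ← Finset.sum_sub_distrib]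
  simp_rw [measureReal_eq_sum_node hμ (G.gam z₀ _), measureReal_eq_sum_node hν (G.gam z₀ _), hf,
    hz₀.setIntegral_shortestPath_node hh, ← Finset.sum_sub_distrib, Finset.sum_mul, ← sub_mul,
    Finset.mul_sum]
  rw [Finset.sum_comm]
  simp only [mul_assoc]

end IsUniquePathRoot

end PhysicalGraph

open PhysicalGraph

theorem theorem3p3 {n : ℕ} (G : PhysicalGraph n) (z₀ : G.V) (hz₀ : G.IsUniquePathRoot z₀)
    (p : ℝ) (hp : 1 ≤ p) (μ ν : Measure G.Point) [IsFiniteMeasure μ] [IsFiniteMeasure ν]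
    (hμ : μ (range G.node)ᶜ = 0) (hν : ν (range G.node)ᶜ = 0) :
    G.regSobolevIPM z₀ G.lengthMeasure (ENNReal.ofReal p) μ ν =
      ENNReal.ofReal ((∑ e : G.Edge,
        G.edgeWeight z₀ p e * |μ.real (G.gam z₀ e) - ν.real (G.gam z₀ e)| ^ p) ^ (1 / p)) := by
  set ρ := G.lengthMeasure.withDensity (G.weight z₀ G.lengthMeasure)
  have : IsFiniteMeasure ρ := isFiniteMeasure_withDensity_weight
  set c : G.Edge → ℝ := fun e => μ.real (G.gam z₀ e) - ν.real (G.gam z₀ e)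
  -- The pairing of `h` with the masses behind the edges is the integral of `h * g` for the
  -- measure `ŵ λ`, whence the weight in the denominator.
  let g : G.Point → ℝ := glue z₀ fun e t => c e / edgeDensity z₀ e t
  have hgm : Measurable g :=
    measurable_glue fun e => measurable_const.div (measurable_edgeDensity e)
  have hgb : ∀ x, |g x| ≤ ∑ e, |c e| := abs_glue_le fun e t ht => by
    have h1 := one_le_edgeDensity (z₀ := z₀) e ht.2
    rw [abs_div, abs_of_pos (zero_lt_one.trans_le h1)]
    exact div_le_self (abs_nonneg _) h1
  have hnorm : ∫ x, |g x| ^ p ∂ρ = ∑ e : G.Edge, G.edgeWeight z₀ p e * |c e| ^ p := by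
    have hint : Integrable (fun x => |g x| ^ p) G.lengthMeasure := by
      have := (memLp_of_abs_le (ρ := G.lengthMeasure) hgm hgb
        (ENNReal.ofReal p)).integrable_norm_rpow'
      rwa [ENNReal.toReal_ofReal (by linarith)] at this
    rw [hz₀.integral_withDensity_weight hint]
    refine Finset.sum_congr rfl fun e _ => ?_
    rw [edgeWeight_eq_integral, mul_assoc, ← integral_mul_const]
    congr 1
    refine setIntegral_congr_fun measurableSet_Ioo fun t ht => ?_
    have h1 := zero_lt_one.trans_le (one_le_edgeDensity (z₀ := z₀) e ht.2.le)
    simp only [g, glue_edgePt _ e ht]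
    rw [abs_div, abs_of_pos h1, Real.div_rpow (abs_nonneg _) h1.le, Real.rpow_sub h1,
      Real.rpow_one]
    ring
  have hpair : ∀ {f h : G.Point → ℝ}, Integrable h G.lengthMeasure → (∀ v, f (G.node v) =
      ∫ y in G.shortestPath (G.node z₀) (G.node v), h y ∂G.lengthMeasure) →
      ∫ x, f x ∂μ - ∫ x, f x ∂ν = ∫ x, h x * g x ∂ρ := by
    intro f h hh hf
    rw [hz₀.integral_sub_integral hμ hν hh hf, hz₀.integral_withDensity_weight
      (hh.mul_bdd hgm.aestronglyMeasurable (ae_of_all _ hgb))]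
    refine Finset.sum_congr rfl fun e _ => ?_
    rw [mul_left_comm, ← integral_const_mul]
    congr 1
    refine setIntegral_congr_fun measurableSet_Ioo fun t ht => ?_
    have h1 := zero_lt_one.trans_le (one_le_edgeDensity (z₀ := z₀) e ht.2.le)
    simp only [g, glue_edgePt _ e ht]
    field_simp
    exact mul_comm _ _
  -- The claim is now the duality of the norms of exponents `p` and `p'` for the measure `ŵ λ`.
  rw [← hnorm, regSobolevIPM]
  apply le_antisymm
  · refine iSup₂_le fun f hf => ?_
    obtain ⟨hf0, h, hfh, hle⟩ := hf
    have hq : 1 ≤ (ENNReal.ofReal p).conjExponent := le_self_add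
    have hh := hfh.memLp.integrable hq
    rw [hpair hh fun v => by rw [← hfh.ftc, hf0, sub_zero]]
    exact ofReal_abs_integral_mul_le hp hgm hgb
      (hh.aestronglyMeasurable.mono_ac (withDensity_absolutelyContinuous _ _)) hle
  · obtain ⟨h, hm, ⟨C, hC⟩, hle, heq⟩ := exists_integral_mul_eq (ρ := ρ) hp hgm hgb
    have hmem := memLp_of_abs_le (ρ := G.lengthMeasure) hm hC
    have hh := (hmem 1).integrable le_rfl
    let f : G.Point → ℝ := fun x => ∫ y in G.shortestPath (G.node z₀) x, h y ∂G.lengthMeasure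
    have hf0 : f (G.node z₀) = 0 := by
      refine setIntegral_measure_zero _ (measure_mono_null ?_ G.lengthMeasure_range_node)
      rw [hz₀.shortestPath_root]
      exact singleton_subset_iff.2 (mem_range_self z₀)
    have hf : f ∈ G.regBall z₀ G.lengthMeasure (ENNReal.ofReal p).conjExponent :=
      ⟨hf0, h, ⟨hz₀.continuous_setIntegral_shortestPath hh, hmem _, fun x => by
        rw [hf0, sub_zero]⟩, hle⟩
    refine le_iSup₂_of_le f hf ?_
    rw [hpair hh fun v => rfl, heq]
    exact ENNReal.ofReal_le_ofReal (le_abs_self _)
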